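/- **Conventions.** All spaces are complex. A *Köthe sequence space* is a Banach space $E\subseteq\mathbb C^{\mathbb N}$ with $\ell_1\subseteq E\subseteq\ell_\infty$, both inclusions of norm at most one, such that $|x(k)|\le|y(k)|$ for all $k$ and $y\in E$ imply $x\in E$ and $\|x\|_E\le\|y\|_E$. For an integer $n\ge1$, $E^{1/n}=\{x\in\ell_\infty:\ |x|^n\in E\}$ with norm $\|x\|_{E^{1/n}}=\|\,|x|^n\|_E^{1/n}$. We write $\ell_p\hookrightarrow E^{1/n}$ if $\ell_p\subseteq E^{1/n}$ with continuous inclusion, and $c_p^{E^{1/n}}$ for the norm of this inclusion. For Köthe sequence spaces $G,E$, $\boldsymbol\ell_n(\mathcal L;G,E)$ is the Köthe sequence space of all $\alpha\in\ell_\infty$ for which $T_\alpha(x_1,\dots,x_n)=\alpha\cdot x_1\cdots x_n$ (coordinatewise products) defines a continuous $n$-linear operator $G\times\cdots\times G\to E$, with norm $\|\alpha\|=\|T_\alpha\|$. For $1\le p<\infty$ and a finite sequence $x=(x_i)_{i=1}^m$ in a Banach space $X$, $w_p(x)=\sup_{\varphi\in B_{X'}}\big(\sum_{i=1}^m|\varphi(x_i)|^p\big)^{1/p}$.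 If $\ell_p\hookrightarrow E^{1/n}$ and $X_1,\dots,X_n,Y$ are Banach spaces, a continuous $n$-linear $T:X_1\times\cdots\times X_n\to Y$ is *$(E,p)$-summing*, $T\in\Pi_{(E,p)}(X_1,\dots,X_n;Y)$, if there is $C>0$ such that $$\Big\|\big(\|T(x_{1,i},\dots,x_{n,i})\|_Y\big)_{i=1}^m\Big\|_E\le C\,c_p^{E^{1/n}}\,w_p(x_1)\cdots w_p(x_n)$$ for all $m$ and all finite sequences $x_j=(x_{j,i})_{i=1}^m$ in $X_j$, $j=1,\dots,n$; $\pi_{(E,p)}(T)$ is the infimum of all such $C$. **Theorem 4.6 (Inclusion theorem).** Let $n\ge1$ and let $E$ be a Köthe sequence space. 1. Let $1\le p<q<\infty$ and $\frac1r=\frac1p-\frac1q$, and suppose $\ell_p\hookrightarrow E^{1/n}$. Then $\ell_q\hookrightarrow[\boldsymbol\ell_n(\mathcal L;\ell_r,E)]^{1/n}$ and, for all Banach spaces $X_1,\dots,X_n,Y$, $$\Pi_{(E,p)}(X_1,\dots,X_n;Y)\subseteq\Pi_{(\boldsymbol\ell_n(\mathcal L;\ell_r,E),\,q)}(X_1,\dots,X_n;Y),$$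 with $$\pi_{(\boldsymbol\ell_n(\mathcal L;\ell_r,E),q)}(T)\le c_p^{E^{1/n}}\cdot\Big(c_q^{[\boldsymbol\ell_n(\mathcal L;\ell_r,E)]^{1/n}}\Big)^{-1}\cdot\pi_{(E,p)}(T)\qquad\text{for all }T\in\Pi_{(E,p)}(X_1,\dots,X_n;Y).$$ 2. If the Banach spaces $X_1,\dots,X_n$ have cotype 2, then for every Banach space $Y$ $$\Pi_{(\boldsymbol\ell_n(\mathcal L;\ell_2,E),\,2)}(X_1,\dots,X_n;Y)=\Pi_{(E,1)}(X_1,\dots,X_n;Y),$$ with equivalent norms $\pi_{(\boldsymbol\ell_n(\mathcal L;\ell_2,E),2)}$ and $\pi_{(E,1)}$. (Here $\ell_1\hookrightarrow E^{1/n}$ holds for every Köthe sequence space $E$.) -/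

import Mathlib

open Filter Topology

noncomputable section

/-- A Köthe (Banach) sequence space: a complex Banach space `E ⊆ ℂ^ℕ` which is normal and satisfies
`ℓ₁ ⊆ E ⊆ ℓ_∞` with inclusions of norm at most one. -/
structure KotheSpace where
  toSubmodule : Submodule ℂ (ℕ → ℂ)
  nrm : toSubmodule → ℝ
  nrm_add_le : ∀ x y, nrm (x + y) ≤ nrm x + nrm y
  nrm_smul : ∀ (c : ℂ) x, nrm (c • x) = ‖c‖ * nrm x
  eq_zero_of_nrm_eq_zero : ∀ x, nrm x = 0 → x = 0
  complete : ∀ u : ℕ → toSubmodule,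
    (∀ ε > 0, ∃ N, ∀ m ≥ N, ∀ k ≥ N, nrm (u m - u k) < ε) →
      ∃ x, Tendsto (fun m => nrm (u m - x)) atTop (𝓝 0)
  normal : ∀ (x : ℕ → ℂ) (y : toSubmodule), (∀ k, ‖x k‖ ≤ ‖(y : ℕ → ℂ) k‖) →
    ∃ h : x ∈ toSubmodule, nrm ⟨x, h⟩ ≤ nrm y
  of_l1 : ∀ x : ℕ → ℂ, Summable (fun k => ‖x k‖) →
    ∃ h : x ∈ toSubmodule, nrm ⟨x, h⟩ ≤ ∑' k, ‖x k‖
  le_linf : ∀ (x : toSubmodule) (k : ℕ), ‖(x : ℕ → ℂ) k‖ ≤ nrm x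

namespace KotheSpace

/-- The underlying Banach space of a Köthe sequence space. (A separate name for the submodule, which
as a subset of `ℕ → ℂ` would carry the product topology.) -/
def Space (E : KotheSpace) : Type := E.toSubmodule

instance (E : KotheSpace) : AddCommGroup E.Space := inferInstanceAs (AddCommGroup E.toSubmodule)
instance (E : KotheSpace) : Module ℂ E.Space := inferInstanceAs (Module ℂ E.toSubmodule)
instance (E : KotheSpace) : Norm E.Space := ⟨E.nrm⟩

/-- The sequence underlying an element of `E`. -/
def Space.seq {E : KotheSpace} (x : E.Space) : ℕ → ℂ := Subtype.val x

theorem nrm_zero (E : KotheSpace) : E.nrm 0 = 0 := by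
  have := E.nrm_smul 0 0
  simpa using this

theorem core (E : KotheSpace) : NormedSpace.Core ℂ E.Space where
  norm_nonneg x := (norm_nonneg _).trans (E.le_linf x 0)
  norm_smul := E.nrm_smul
  norm_triangle := E.nrm_add_le
  norm_eq_zero_iff x := ⟨E.eq_zero_of_nrm_eq_zero x, fun h => by subst h; exact E.nrm_zero⟩

instance (E : KotheSpace) : NormedAddCommGroup E.Space := NormedAddCommGroup.ofCore E.core
instance (E : KotheSpace) : NormedSpace ℂ E.Space := NormedSpace.ofCore E.core

instance (E : KotheSpace) : CompleteSpace E.Space := by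
  apply Metric.complete_of_cauchySeq_tendsto
  intro u hu
  obtain ⟨x, hx⟩ := E.complete u (by
    intro ε hε
    obtain ⟨N, hN⟩ := Metric.cauchySeq_iff.1 hu ε hε
    refine ⟨N, fun m hm k hk => ?_⟩
    have := hN m hm k hk
    rwa [dist_eq_norm] at this)
  exact ⟨x, tendsto_iff_norm_sub_tendsto_zero.2 hx⟩

theorem norm_seq_le {E : KotheSpace} (x : E.Space) (k : ℕ) : ‖x.seq k‖ ≤ ‖x‖ := E.le_linf x k

theorem Space.ext {E : KotheSpace} {x y : E.Space} (h : x.seq = y.seq) : x = y := Subtype.ext h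

theorem ell_toReal {p : ℝ} (hp : 1 ≤ p) : (ENNReal.ofReal p).toReal = p :=
  ENNReal.toReal_ofReal (by linarith)

theorem ell_fact {p : ℝ} (hp : 1 ≤ p) : Fact (1 ≤ ENNReal.ofReal p) :=
  ⟨by rw [← ENNReal.ofReal_one]; exact ENNReal.ofReal_le_ofReal hp⟩

theorem ell_mem {p : ℝ} (hp : 1 ≤ p) (x : ℕ → ℂ) :
    Memℓp x (ENNReal.ofReal p) ↔ Summable fun k => ‖x k‖ ^ p := by
  rw [memℓp_gen_iff (by rw [ell_toReal hp]; linarith), ell_toReal hp]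

theorem ell_norm {p : ℝ} (hp : 1 ≤ p) (x : lp (fun _ : ℕ => ℂ) (ENNReal.ofReal p)) :
    ‖x‖ = (∑' k, ‖(x : ℕ → ℂ) k‖ ^ p) ^ (1 / p) := by
  rw [lp.norm_eq_tsum_rpow (by rw [ell_toReal hp]; linarith), ell_toReal hp]

/-- The Köthe sequence space `ℓ_p`, `1 ≤ p < ∞`, with `‖x‖ = (∑ |x(k)|^p)^{1/p}`. -/
def ell (p : ℝ) (hp : 1 ≤ p) : KotheSpace where
  toSubmodule :=
    { carrier := {x | Summable fun k => ‖x k‖ ^ p}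
      add_mem' := fun {x y} hx hy =>
        (ell_mem hp _).1 (((ell_mem hp x).2 hx).add ((ell_mem hp y).2 hy))
      zero_mem' := (ell_mem hp _).1 zero_memℓp
      smul_mem' := fun c x hx => (ell_mem hp _).1 (((ell_mem hp x).2 hx).const_smul c) }
  nrm x := (∑' k, ‖(x : ℕ → ℂ) k‖ ^ p) ^ (1 / p)
  nrm_add_le x y := by
    have := ell_fact hp
    let x' : lp (fun _ : ℕ => ℂ) (ENNReal.ofReal p) := ⟨x.1, (ell_mem hp _).2 x.2⟩
    let y' : lp (fun _ : ℕ => ℂ) (ENNReal.ofReal p) := ⟨y.1, (ell_mem hp _).2 y.2⟩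
    have := norm_add_le x' y'
    rw [ell_norm hp, ell_norm hp, ell_norm hp] at this
    exact this
  nrm_smul c x := by
    have := ell_fact hp
    let x' : lp (fun _ : ℕ => ℂ) (ENNReal.ofReal p) := ⟨x.1, (ell_mem hp _).2 x.2⟩
    have := norm_smul c x'
    rw [ell_norm hp, ell_norm hp] at this
    exact this
  eq_zero_of_nrm_eq_zero x hx := by
    have := ell_fact hp
    let x' : lp (fun _ : ℕ => ℂ) (ENNReal.ofReal p) := ⟨x.1, (ell_mem hp _).2 x.2⟩
    have h : ‖x'‖ = 0 := by rw [ell_norm hp]; exact hx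
    have h0 : x' = 0 := norm_eq_zero.1 h
    have h1 : x'.1 = 0 := congrArg Subtype.val h0
    exact Subtype.ext h1
  complete u hu := by
    have := ell_fact hp
    let u' : ℕ → lp (fun _ : ℕ => ℂ) (ENNReal.ofReal p) :=
      fun m => ⟨(u m).1, (ell_mem hp _).2 (u m).2⟩
    have hc : CauchySeq u' := by
      refine Metric.cauchySeq_iff.2 fun ε hε => ?_
      obtain ⟨N, hN⟩ := hu ε hε
      refine ⟨N, fun m hm k hk => ?_⟩
      rw [dist_eq_norm, ell_norm hp]
      exact hN m hm k hk
    obtain ⟨x, hx⟩ := cauchySeq_tendsto_of_complete hc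
    refine ⟨⟨x.1, (ell_mem hp _).1 x.2⟩, ?_⟩
    refine (tendsto_iff_norm_sub_tendsto_zero.1 hx).congr fun m => ?_
    rw [ell_norm hp]
    rfl
  normal x y h := by
    have hp0 : 0 < p := by linarith
    have hle : ∀ k, ‖x k‖ ^ p ≤ ‖(y : ℕ → ℂ) k‖ ^ p :=
      fun k => Real.rpow_le_rpow (norm_nonneg _) (h k) hp0.le
    have hs : Summable fun k => ‖x k‖ ^ p :=
      Summable.of_nonneg_of_le (fun k => by positivity) hle y.2
    exact ⟨hs, Real.rpow_le_rpow (tsum_nonneg fun k => by positivity)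
      (hs.tsum_le_tsum hle y.2) (by positivity)⟩
  of_l1 x h := by
    have hp0 : 0 < p := by linarith
    set S := ∑' k, ‖x k‖ with hS
    have hS0 : 0 ≤ S := tsum_nonneg fun k => norm_nonneg _
    have hk : ∀ k, ‖x k‖ ≤ S := fun k => h.le_tsum k fun _ _ => norm_nonneg _
    have hle : ∀ k, ‖x k‖ ^ p ≤ S ^ (p - 1) * ‖x k‖ := by
      intro k
      rcases (norm_nonneg (x k)).eq_or_lt with h0 | h0
      · rw [← h0, Real.zero_rpow hp0.ne', mul_zero]
      · calc ‖x k‖ ^ p = ‖x k‖ ^ (p - 1) * ‖x k‖ := by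
              rw [Real.rpow_sub_one h0.ne']; field_simp
          _ ≤ _ := by
              exact mul_le_mul_of_nonneg_right
                (Real.rpow_le_rpow h0.le (hk k) (by linarith)) h0.le
    have hs : Summable fun k => ‖x k‖ ^ p :=
      Summable.of_nonneg_of_le (fun k => by positivity) hle (h.mul_left _)
    refine ⟨hs, ?_⟩
    have h1 : ∑' k, ‖x k‖ ^ p ≤ S ^ p := by
      refine (hs.tsum_le_tsum hle (h.mul_left _)).trans ?_
      rw [tsum_mul_left, ← hS]
      rcases hS0.eq_or_lt with h0 | h0
      · rw [← h0, mul_zero]; positivity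
      · rw [Real.rpow_sub_one h0.ne']; field_simp; exact le_rfl
    calc (∑' k, ‖x k‖ ^ p) ^ (1 / p) ≤ (S ^ p) ^ (1 / p) :=
          Real.rpow_le_rpow (tsum_nonneg fun k => by positivity) h1 (by positivity)
      _ = S := by rw [← Real.rpow_mul hS0, mul_one_div_cancel hp0.ne', Real.rpow_one]
  le_linf x k := by
    have hp0 : 0 < p := by linarith
    have h1 : ‖(x : ℕ → ℂ) k‖ ^ p ≤ ∑' k, ‖(x : ℕ → ℂ) k‖ ^ p :=
      Summable.le_tsum x.2 k fun _ _ => by positivity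
    calc ‖(x : ℕ → ℂ) k‖ = (‖(x : ℕ → ℂ) k‖ ^ p) ^ (1 / p) := by
          rw [← Real.rpow_mul (norm_nonneg _), mul_one_div_cancel hp0.ne', Real.rpow_one]
      _ ≤ _ := Real.rpow_le_rpow (by positivity) h1 (by positivity)

/-- `T : E × ⋯ × E → F` is the diagonal `n`-linear operator `T_α` associated with the sequence `α`:
`T_α(x₁,…,xₙ) = α · x₁ ⋯ xₙ`. -/
def IsDiagonal {n : ℕ} {E F : KotheSpace} (α : ℕ → ℂ)
    (T : ContinuousMultilinearMap ℂ (fun _ : Fin n => E.Space) F.Space) : Prop :=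
  ∀ x k, (T x).seq k = α k * ∏ j, (x j).seq k

theorem IsDiagonal.unique {n : ℕ} {E F : KotheSpace} {α : ℕ → ℂ}
    {S T : ContinuousMultilinearMap ℂ (fun _ : Fin n => E.Space) F.Space}
    (hS : IsDiagonal α S) (hT : IsDiagonal α T) : S = T := by
  ext x
  exact Space.ext (funext fun k => (hS x k).trans (hT x k).symm)

theorem exists_unit (E : KotheSpace) (k : ℕ) : ∃ e : E.Space, e.seq k = 1 ∧ ‖e‖ ≤ 1 := by
  have hs : HasSum (fun i => ‖(Pi.single k 1 : ℕ → ℂ) i‖) 1 := by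
    convert hasSum_ite_eq k (1 : ℝ) using 2 with i
    by_cases h : i = k
    · subst h; simp
    · simp [h]
  obtain ⟨h, hn⟩ := E.of_l1 (Pi.single k 1) hs.summable
  refine ⟨⟨_, h⟩, Pi.single_eq_same _ _, ?_⟩
  rw [hs.tsum_eq] at hn
  exact hn

theorem IsDiagonal.norm_le {n : ℕ} {E F : KotheSpace} {α : ℕ → ℂ}
    {T : ContinuousMultilinearMap ℂ (fun _ : Fin n => E.Space) F.Space}
    (hT : IsDiagonal α T) (k : ℕ) : ‖α k‖ ≤ ‖T‖ := by
  obtain ⟨e, he, hn⟩ := E.exists_unit k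
  have h := hT (fun _ => e) k
  simp only [he, Finset.prod_const_one, mul_one] at h
  rw [← h]
  refine (norm_seq_le _ k).trans ((T.le_opNorm _).trans ?_)
  exact mul_le_of_le_one_right (norm_nonneg _)
    (Finset.prod_le_one (fun _ _ => norm_nonneg _) fun _ _ => hn)

theorem IsDiagonal.bdd {n : ℕ} {E F : KotheSpace} {α : ℕ → ℂ}
    {T : ContinuousMultilinearMap ℂ (fun _ : Fin n => E.Space) F.Space}
    (hT : IsDiagonal α T) : BddAbove (Set.range fun k => ‖α k‖) :=
  ⟨‖T‖, by rintro _ ⟨k, rfl⟩; exact hT.norm_le k⟩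

theorem IsDiagonal.add {n : ℕ} {E F : KotheSpace} {α β : ℕ → ℂ}
    {S T : ContinuousMultilinearMap ℂ (fun _ : Fin n => E.Space) F.Space}
    (hS : IsDiagonal α S) (hT : IsDiagonal β T) : IsDiagonal (α + β) (S + T) := fun x k => by
  have : ((S + T) x).seq k = (S x).seq k + (T x).seq k := rfl
  rw [this, hS, hT, Pi.add_apply, add_mul]

theorem IsDiagonal.sub {n : ℕ} {E F : KotheSpace} {α β : ℕ → ℂ}
    {S T : ContinuousMultilinearMap ℂ (fun _ : Fin n => E.Space) F.Space}
    (hS : IsDiagonal α S) (hT : IsDiagonal β T) : IsDiagonal (α - β) (S - T) := fun x k => by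
  have : ((S - T) x).seq k = (S x).seq k - (T x).seq k := rfl
  rw [this, hS, hT, Pi.sub_apply, sub_mul]

theorem IsDiagonal.smul {n : ℕ} {E F : KotheSpace} {α : ℕ → ℂ}
    {T : ContinuousMultilinearMap ℂ (fun _ : Fin n => E.Space) F.Space} (c : ℂ)
    (hT : IsDiagonal α T) : IsDiagonal (c • α) (c • T) := fun x k => by
  have : ((c • T) x).seq k = c * (T x).seq k := rfl
  rw [this, hT, Pi.smul_apply, smul_eq_mul, mul_assoc]

theorem IsDiagonal.zero {n : ℕ} {E F : KotheSpace} :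
    IsDiagonal 0 (0 : ContinuousMultilinearMap ℂ (fun _ : Fin n => E.Space) F.Space) :=
  fun x k => by
    have : ((0 : ContinuousMultilinearMap ℂ (fun _ : Fin n => E.Space) F.Space) x).seq k = 0 := rfl
    rw [this, Pi.zero_apply, zero_mul]

theorem exists_mulCLM (F : KotheSpace) (s : ℕ → ℂ) (hs : ∀ k, ‖s k‖ ≤ 1) :
    ∃ M : F.Space →L[ℂ] F.Space, ‖M‖ ≤ 1 ∧ ∀ x k, (M x).seq k = s k * x.seq k := by
  have key : ∀ x : F.Space, ∃ y : F.Space, ‖y‖ ≤ ‖x‖ ∧ ∀ k, y.seq k = s k * x.seq k := by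
    intro x
    obtain ⟨h, hn⟩ := F.normal (fun k => s k * x.seq k) x fun k => by
      rw [norm_mul]
      exact mul_le_of_le_one_left (norm_nonneg _) (hs k)
    exact ⟨⟨_, h⟩, hn, fun k => rfl⟩
  choose f hf hfs using key
  let L : F.Space →ₗ[ℂ] F.Space :=
    { toFun := f
      map_add' := fun x y => Space.ext (funext fun k => by
        have h1 : (f x + f y).seq k = (f x).seq k + (f y).seq k := rfl
        have h2 : (x + y).seq k = x.seq k + y.seq k := rfl
        rw [h1, hfs, hfs, hfs, h2, mul_add])
      map_smul' := fun c x => Space.ext (funext fun k => by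
        have h1 : ((RingHom.id ℂ) c • f x).seq k = c * (f x).seq k := rfl
        have h2 : (c • x).seq k = c * x.seq k := rfl
        rw [h1, hfs, hfs, h2, mul_left_comm]) }
  refine ⟨L.mkContinuous 1 fun x => by rw [one_mul]; exact hf x,
    L.mkContinuous_norm_le zero_le_one _, fun x k => hfs x k⟩

theorem exists_diagonal_of_le {n : ℕ} {E F : KotheSpace} {α β : ℕ → ℂ}
    {T : ContinuousMultilinearMap ℂ (fun _ : Fin n => E.Space) F.Space} (hT : IsDiagonal β T)
    (h : ∀ k, ‖α k‖ ≤ ‖β k‖) :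
    ∃ S : ContinuousMultilinearMap ℂ (fun _ : Fin n => E.Space) F.Space,
      IsDiagonal α S ∧ ‖S‖ ≤ ‖T‖ := by
  obtain ⟨M, hM, hMs⟩ := F.exists_mulCLM (fun k => α k / β k) fun k => by
    rw [norm_div]
    exact div_le_one_of_le₀ (h k) (norm_nonneg _)
  refine ⟨M.compContinuousMultilinearMap T, fun x k => ?_, ?_⟩
  · have h1 : ((M.compContinuousMultilinearMap T) x).seq k = (M (T x)).seq k := rfl
    rw [h1, hMs, hT, ← mul_assoc]
    congr 1
    by_cases hb : β k = 0
    · have := h k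
      rw [hb, norm_zero] at this
      rw [hb, mul_zero, norm_le_zero_iff.1 this]
    · exact div_mul_cancel₀ _ hb
  · refine (M.norm_compContinuousMultilinearMap_le T).trans ?_
    exact mul_le_of_le_one_left (norm_nonneg _) hM

theorem exists_diagonal_of_l1 (n : ℕ) (E F : KotheSpace) {α : ℕ → ℂ}
    (hα : Summable fun k => ‖α k‖) :
    ∃ S : ContinuousMultilinearMap ℂ (fun _ : Fin n => E.Space) F.Space,
      IsDiagonal α S ∧ ‖S‖ ≤ ∑' k, ‖α k‖ := by
  have key : ∀ x : Fin n → E.Space, ∃ y : F.Space, ‖y‖ ≤ (∑' k, ‖α k‖) * ∏ j, ‖x j‖ ∧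
      ∀ k, y.seq k = α k * ∏ j, (x j).seq k := by
    intro x
    have hle : ∀ k, ‖α k * ∏ j, (x j).seq k‖ ≤ ‖α k‖ * ∏ j, ‖x j‖ := fun k => by
      rw [norm_mul, norm_prod]
      gcongr with j
      exact norm_seq_le _ k
    have hs : Summable fun k => ‖α k * ∏ j, (x j).seq k‖ :=
      Summable.of_nonneg_of_le (fun k => norm_nonneg _) hle (hα.mul_right _)
    obtain ⟨h, hn⟩ := F.of_l1 _ hs
    refine ⟨⟨_, h⟩, hn.trans ?_, fun k => rfl⟩
    rw [← tsum_mul_right]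
    exact hs.tsum_le_tsum hle (hα.mul_right _)
  choose f hf hfs using key
  let L : MultilinearMap ℂ (fun _ : Fin n => E.Space) F.Space :=
    { toFun := f
      map_update_add' := fun {dec} x i a b => Space.ext (funext fun k => by
        obtain rfl : dec = instDecidableEqFin n := Subsingleton.elim _ _
        have h1 : ∀ u v : F.Space, (u + v).seq k = u.seq k + v.seq k := fun _ _ => rfl
        have h2 : (a + b).seq k = a.seq k + b.seq k := rfl
        have h3 : ∀ c : E.Space, ∏ j, (Function.update x i c j).seq k =
            c.seq k * ∏ j ∈ Finset.univ \ {i}, (x j).seq k := fun c => by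
          rw [← Finset.prod_update_of_mem (Finset.mem_univ i)]
          refine Finset.prod_congr rfl fun j _ => ?_
          by_cases hj : j = i
          · subst hj; simp
          · simp [hj]
        rw [h1, hfs, hfs, hfs, h3, h3, h3, h2]
        ring)
      map_update_smul' := fun {dec} x i c a => Space.ext (funext fun k => by
        obtain rfl : dec = instDecidableEqFin n := Subsingleton.elim _ _
        have h1 : ∀ u : F.Space, (c • u).seq k = c * u.seq k := fun _ => rfl
        have h2 : (c • a).seq k = c * a.seq k := rfl
        have h3 : ∀ c : E.Space, ∏ j, (Function.update x i c j).seq k =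
            c.seq k * ∏ j ∈ Finset.univ \ {i}, (x j).seq k := fun c => by
          rw [← Finset.prod_update_of_mem (Finset.mem_univ i)]
          refine Finset.prod_congr rfl fun j _ => ?_
          by_cases hj : j = i
          · subst hj; simp
          · simp [hj]
        rw [h1, hfs, hfs, h3, h3, h2]
        ring) }
  exact ⟨L.mkContinuous _ hf, fun x k => hfs x k,
    L.mkContinuous_norm_le (tsum_nonneg fun _ => norm_nonneg _) hf⟩

theorem exists_diagonal_of_tendsto {n : ℕ} {E F : KotheSpace} {u : ℕ → ℕ → ℂ}
    {T : ℕ → ContinuousMultilinearMap ℂ (fun _ : Fin n => E.Space) F.Space}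
    (hT : ∀ m, IsDiagonal (u m) (T m))
    {S : ContinuousMultilinearMap ℂ (fun _ : Fin n => E.Space) F.Space}
    (hS : Tendsto T atTop (𝓝 S)) : ∃ α, IsDiagonal α S := by
  have hpt : ∀ x k, Tendsto (fun m => (T m x).seq k) atTop (𝓝 ((S x).seq k)) := by
    intro x k
    rw [tendsto_iff_norm_sub_tendsto_zero] at hS ⊢
    have h0 : Tendsto (fun m => ‖T m - S‖ * ∏ j, ‖x j‖) atTop (𝓝 0) := by
      simpa using hS.mul_const (∏ j, ‖x j‖)
    refine squeeze_zero (fun _ => norm_nonneg _) (fun m => ?_) h0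
    exact (norm_seq_le ((T m - S) x) k).trans ((T m - S).le_opNorm x)
  choose e he _ using fun k => E.exists_unit k
  refine ⟨fun k => (S fun _ => e k).seq k, fun x k => ?_⟩
  refine tendsto_nhds_unique (hpt x k) ?_
  have h1 : ∀ m, (T m x).seq k = (T m fun _ => e k).seq k * ∏ j, (x j).seq k := fun m => by
    rw [hT, hT]
    simp [he]
  simp only [h1]
  exact (hpt _ k).mul_const _

/-- The sequence space `ℓ_n(𝓛; E, F)` associated with the ideal `𝓛` of all continuous `n`-linear
operators: the bounded sequences `α` such that `T_α ∈ 𝓛(ⁿE; F)`, normed by `‖α‖ = ‖T_α‖`. -/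
def ellN (n : ℕ) (E F : KotheSpace) : KotheSpace where
  toSubmodule :=
    { carrier := {α | BddAbove (Set.range fun k => ‖α k‖) ∧
        ∃ T : ContinuousMultilinearMap ℂ (fun _ : Fin n => E.Space) F.Space, IsDiagonal α T}
      add_mem' := by
        rintro α β ⟨_, S, hS⟩ ⟨_, T, hT⟩
        exact ⟨(hS.add hT).bdd, _, hS.add hT⟩
      zero_mem' := ⟨(IsDiagonal.zero (n := n) (E := E) (F := F)).bdd, _, IsDiagonal.zero⟩
      smul_mem' := by
        rintro c α ⟨_, T, hT⟩
        exact ⟨(hT.smul c).bdd, _, hT.smul c⟩ }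
  nrm α := ‖α.2.2.choose‖
  nrm_add_le α β := by
    rw [(α + β).2.2.choose_spec.unique (α.2.2.choose_spec.add β.2.2.choose_spec)]
    exact norm_add_le _ _
  nrm_smul c α := by
    rw [(c • α).2.2.choose_spec.unique (α.2.2.choose_spec.smul c)]
    exact norm_smul _ _
  eq_zero_of_nrm_eq_zero α h := by
    refine Subtype.ext (funext fun k => ?_)
    have := α.2.2.choose_spec.norm_le k
    rw [h] at this
    exact norm_le_zero_iff.1 this
  complete u hu := by
    have hsub : ∀ m k, (u m - u k).2.2.choose = (u m).2.2.choose - (u k).2.2.choose := fun m k =>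
      (u m - u k).2.2.choose_spec.unique ((u m).2.2.choose_spec.sub (u k).2.2.choose_spec)
    have hc : CauchySeq fun m => (u m).2.2.choose := by
      refine Metric.cauchySeq_iff.2 fun ε hε => ?_
      obtain ⟨N, hN⟩ := hu ε hε
      refine ⟨N, fun m hm k hk => ?_⟩
      rw [dist_eq_norm, ← hsub]
      exact hN m hm k hk
    obtain ⟨S, hS⟩ := cauchySeq_tendsto_of_complete hc
    obtain ⟨α, hα⟩ := exists_diagonal_of_tendsto (fun m => (u m).2.2.choose_spec) hS
    refine ⟨⟨α, hα.bdd, S, hα⟩, ?_⟩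
    refine (tendsto_iff_norm_sub_tendsto_zero.1 hS).congr fun m => ?_
    congr 1
    exact ((u m).2.2.choose_spec.sub hα).unique (Exists.choose_spec (_ : ∃ T, IsDiagonal _ T))
  normal α β h := by
    obtain ⟨S, hS, hn⟩ := exists_diagonal_of_le β.2.2.choose_spec h
    have hm : BddAbove (Set.range fun k => ‖α k‖) ∧ ∃ T : ContinuousMultilinearMap ℂ
        (fun _ : Fin n => E.Space) F.Space, IsDiagonal α T := ⟨hS.bdd, S, hS⟩
    refine ⟨hm, ?_⟩
    have : hm.2.choose = S := hm.2.choose_spec.unique hS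
    exact (congrArg norm this).trans_le hn
  of_l1 α h := by
    obtain ⟨S, hS, hn⟩ := exists_diagonal_of_l1 n E F h
    have hm : BddAbove (Set.range fun k => ‖α k‖) ∧ ∃ T : ContinuousMultilinearMap ℂ
        (fun _ : Fin n => E.Space) F.Space, IsDiagonal α T := ⟨hS.bdd, S, hS⟩
    refine ⟨hm, ?_⟩
    have : hm.2.choose = S := hm.2.choose_spec.unique hS
    exact (congrArg norm this).trans_le hn
  le_linf α k := α.2.2.choose_spec.norm_le k

/-- The sequence space `ℓ_n(𝓛; ℓ_r, E)`. -/
abbrev ellNLp (E : KotheSpace) (n : ℕ) (r : ℝ) (hr : 1 ≤ r) : KotheSpace := ellN n (ell r hr) E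

open scoped Classical in
/-- The norm in `E` of a sequence (used only for sequences that belong to `E`; `0` otherwise). -/
def seqNorm (E : KotheSpace) (x : ℕ → ℂ) : ℝ :=
  if h : x ∈ E.toSubmodule then E.nrm ⟨x, h⟩ else 0

/-- Membership in the `1/n`-convexification `E^{1/n} = {x ∈ ℓ_∞ : |x|^n ∈ E}`. -/
def MemRoot (E : KotheSpace) (n : ℕ) (x : ℕ → ℂ) : Prop :=
  BddAbove (Set.range fun k => ‖x k‖) ∧ (fun k => ((‖x k‖ ^ n : ℝ) : ℂ)) ∈ E.toSubmodule

/-- The norm of `E^{1/n}`: `‖x‖ = ‖ |x|^n ‖_E^{1/n}`. -/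
def rootNorm (E : KotheSpace) (n : ℕ) (x : ℕ → ℂ) : ℝ :=
  (E.seqNorm fun k => ((‖x k‖ ^ n : ℝ) : ℂ)) ^ (1 / (n : ℝ))

/-- `ℓ_p ⊆ E^{1/n}` and the inclusion is bounded with constant `C`. -/
def LpBound (E : KotheSpace) (n : ℕ) (p C : ℝ) : Prop :=
  ∀ x : ℕ → ℂ, Summable (fun k => ‖x k‖ ^ p) →
    E.MemRoot n x ∧ E.rootNorm n x ≤ C * (∑' k, ‖x k‖ ^ p) ^ (1 / p)

/-- `ℓ_p ↪ E^{1/n}`: continuous inclusion. -/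
def LpEmbeds (E : KotheSpace) (n : ℕ) (p : ℝ) : Prop := ∃ C, 0 ≤ C ∧ E.LpBound n p C

/-- `c_p^{E^{1/n}}`, the norm of the inclusion `ℓ_p ↪ E^{1/n}`. -/
def inclNorm (E : KotheSpace) (n : ℕ) (p : ℝ) : ℝ := sInf {C | 0 ≤ C ∧ E.LpBound n p C}

end KotheSpace

/-- The weak `ℓ_p`-norm `w_p(x) = sup_{φ ∈ B_{X'}} (∑ |φ(x_i)|^p)^{1/p}` of a finite sequence. -/
def weakLpNorm {X : Type*} [NormedAddCommGroup X] [NormedSpace ℂ X] (p : ℝ) {m : ℕ}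
    (x : Fin m → X) : ℝ :=
  ⨆ φ : {φ : StrongDual ℂ X // ‖φ‖ ≤ 1}, (∑ i, ‖φ.1 (x i)‖ ^ p) ^ (1 / p)

/-- A finite family of real numbers, as a complex sequence extended by zero. -/
def extendZero {m : ℕ} (a : Fin m → ℝ) : ℕ → ℂ := fun k => if h : k < m then (a ⟨k, h⟩ : ℂ) else 0

namespace KotheSpace

section Summing

variable {n : ℕ} {X : Fin n → Type*} [∀ j, NormedAddCommGroup (X j)] [∀ j, NormedSpace ℂ (X j)]
  {Y : Type*} [NormedAddCommGroup Y] [NormedSpace ℂ Y]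

/-- The defining inequality of `(E,p)`-summing `n`-linear operators, with constant `C`. -/
def SummingBound (E : KotheSpace) (p : ℝ) (T : ContinuousMultilinearMap ℂ X Y) (C : ℝ) : Prop :=
  ∀ (m : ℕ) (x : ∀ j, Fin m → X j),
    E.seqNorm (extendZero fun i => ‖T fun j => x j i‖) ≤
      C * E.inclNorm n p * ∏ j, weakLpNorm p (x j)

variable (X Y) in
/-- `Π_{(E,p)}(X₁,…,Xₙ;Y)`, the `(E,p)`-summing `n`-linear operators
(meaningful when `ℓ_p ↪ E^{1/n}`). -/
def summing (E : KotheSpace) (p : ℝ) : Set (ContinuousMultilinearMap ℂ X Y) :=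
  {T | ∃ C > 0, E.SummingBound p T C}

/-- The norm `π_{(E,p)}(T)`. -/
def summingNorm (E : KotheSpace) (p : ℝ) (T : ContinuousMultilinearMap ℂ X Y) : ℝ :=
  sInf {C | 0 < C ∧ E.SummingBound p T C}

end Summing

end KotheSpace

/-- `X` has (Rademacher) cotype 2; the mean is over all choices of signs. -/
def HasCotypeTwo (X : Type*) [NormedAddCommGroup X] [NormedSpace ℂ X] : Prop :=
  ∃ C : ℝ, 0 ≤ C ∧ ∀ (m : ℕ) (x : Fin m → X),
    √(∑ i, ‖x i‖ ^ 2) ≤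
      C * √((1 / 2 ^ m : ℝ) * ∑ s : Fin m → Bool, ‖∑ i, (if s i then x i else -x i)‖ ^ 2)

/-- If `1 ≤ p < q < ∞` and `1/r = 1/p - 1/q`, then `r ≥ 1`, so that `ℓ_r` is a Banach space. -/
theorem one_le_of_inv_eq {p q r : ℝ} (hp : 1 ≤ p) (hpq : p < q) (hr : 1 / r = 1 / p - 1 / q) :
    1 ≤ r := by
  have hp0 : 0 < p := by linarith
  have hq0 : 0 < q := by linarith
  have h1 : 1 / q < 1 / p := one_div_lt_one_div_of_lt hp0 hpq
  have h2 : 1 / p ≤ 1 := by rw [div_le_one hp0]; exact hp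
  have h3 : 0 < 1 / q := by positivity
  have hr0 : 0 < r := one_div_pos.1 (by linarith)
  exact (div_le_one hr0).1 (by linarith)

end

/-! Part 1 is Hölder's inequality. To bound the sequence of norms `‖T(x_{1,i},…,x_{n,i})‖` in
`ℓ_n(𝓛; ℓ_r, E)` is to bound it in `E` after multiplication by `λ₁⋯λₙ` with `λ_j ∈ ℓ_r`.
Multilinearity absorbs `λ_j` into `x_j`, and `w_p(λ_j x_j) ≤ ‖λ_j‖_r w_q(x_j)`. The embedding of
`ℓ_q` holds for the same reason: each `λ_j |x|` lies in `ℓ_p`, and products of `n` elements of `ℓ_p`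
lie in `E`.

In part 2 one inclusion is the case `p = 1`, `q = r = 2`. The converse reverses the Hölder step:
with cotype 2, every finite sequence is `x = λ y` with `‖λ‖₂ ≤ 1` and `w₂(y) ≤ K w₁(x)`, where `K`
depends only on the space (`HasCotypeTwo.exists_factorization`).

For this, consider `u : ℓ_∞^m → X`, `u(e_i) = x_i`, of norm `w₁(x)`. It is 2-summing with a constant
independent of `m` (`twoSummingBound_of_cotype`). Indeed cotype bounds `∑ ‖u(a_k)‖²` by the mean of
`‖u(∑ ±a_k)‖²`. Truncate the random vector `∑ ±a_k` coordinatewise: `‖u‖` controls the bounded part,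
while the tail is small by a fourth-moment estimate and is fed back into the 2-summing bound. So a
bound `M` improves to `A + M/2`, and iteration gives `2A`. Pietsch domination
(`TwoSummingBound.exists_weights`) then provides a probability `μ` on the coordinates, and `λ = √μ`.
-/

/-! ### Rademacher sums -/

section Rademacher

/-- The sum `∑ ±x i` with signs given by `s`. -/
def signSum {V : Type*} [AddCommGroup V] {N : ℕ} (x : Fin N → V) (s : Fin N → Bool) : V :=
  ∑ i, (if s i then x i else -x i)

theorem signSum_cons {V : Type*} [AddCommGroup V] {N : ℕ} (x : Fin (N + 1) → V) (b : Bool)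
    (s : Fin N → Bool) :
    signSum x (Fin.cons b s : Fin (N + 1) → Bool) =
      (if b then x 0 else -x 0) + signSum (fun i => x i.succ) s := by
  simp [signSum, Fin.sum_univ_succ]

theorem sum_signs_succ {N : ℕ} (F : (Fin (N + 1) → Bool) → ℝ) :
    ∑ s, F s = ∑ s : Fin N → Bool, (F (Fin.cons true s : Fin (N + 1) → Bool) +
      F (Fin.cons false s : Fin (N + 1) → Bool)) := by
  rw [← (Fin.consEquiv fun _ : Fin (N + 1) => Bool).sum_comp, Fintype.sum_prod_type_right]
  simp [Fin.consEquiv]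

/-- Orthogonality of the signs: the parallelogram law removes the first sign in each induction step.
-/
theorem sum_norm_signSum_sq {N : ℕ} (z : Fin N → ℂ) :
    ∑ s, ‖signSum z s‖ ^ 2 = 2 ^ N * ∑ i, ‖z i‖ ^ 2 := by
  induction N with
  | zero => simp [signSum]
  | succ N ih =>
    rw [sum_signs_succ]
    have key : ∀ s : Fin N → Bool, ‖signSum z (Fin.cons true s : Fin (N + 1) → Bool)‖ ^ 2 +
        ‖signSum z (Fin.cons false s : Fin (N + 1) → Bool)‖ ^ 2 =
        2 * ‖z 0‖ ^ 2 + 2 * ‖signSum (fun i => z i.succ) s‖ ^ 2 := fun s => by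
      simp only [signSum_cons, if_true, Bool.false_eq_true, if_false, Complex.sq_norm,
        Complex.normSq_apply, Complex.add_re, Complex.add_im, Complex.neg_re, Complex.neg_im]
      ring
    simp only [key, Finset.sum_add_distrib, ← Finset.mul_sum, ih, Fin.sum_univ_succ]
    simp
    ring

/-- Khinchine's inequality for the fourth moment, needed to make the truncated tails small in mean
square. -/
theorem sum_norm_signSum_pow_four_le {N : ℕ} (z : Fin N → ℂ) :
    ∑ s, ‖signSum z s‖ ^ 4 ≤ 2 ^ N * (3 * (∑ i, ‖z i‖ ^ 2) ^ 2) := by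
  induction N with
  | zero => simp [signSum]
  | succ N ih =>
    rw [sum_signs_succ]
    have key : ∀ s : Fin N → Bool, ‖signSum z (Fin.cons true s : Fin (N + 1) → Bool)‖ ^ 4 +
        ‖signSum z (Fin.cons false s : Fin (N + 1) → Bool)‖ ^ 4 ≤
        2 * ‖z 0‖ ^ 4 + 12 * ‖z 0‖ ^ 2 * ‖signSum (fun i => z i.succ) s‖ ^ 2 +
          2 * ‖signSum (fun i => z i.succ) s‖ ^ 4 := fun s => by
      have h4 : ∀ w : ℂ, ‖w‖ ^ 4 = (‖w‖ ^ 2) ^ 2 := fun w => by ring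
      simp only [h4, signSum_cons, if_true, Bool.false_eq_true, if_false, Complex.sq_norm,
        Complex.normSq_apply, Complex.add_re, Complex.add_im, Complex.neg_re, Complex.neg_im]
      -- With `a = z 0` and `b` the remaining sum, the left side is `2(|a|² + |b|²)² + 8 Re(a b̄)²`,
      -- and `Re(a b̄)² = |a|²|b|² - Im(a b̄)²`.
      nlinarith [sq_nonneg ((z 0).re * (signSum (fun i => z i.succ) s).im -
        (z 0).im * (signSum (fun i => z i.succ) s).re)]
    refine (Finset.sum_le_sum fun s _ => key s).trans ?_
    simp only [Finset.sum_add_distrib, ← Finset.mul_sum, sum_norm_signSum_sq, Fin.sum_univ_succ]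
    have := ih fun i => z i.succ
    have hN : (0 : ℝ) ≤ 2 ^ N * ‖z 0‖ ^ 4 := by positivity
    simp only [Finset.sum_const, Finset.card_univ, Fintype.card_fun, Fintype.card_bool,
      Fintype.card_fin, nsmul_eq_mul, Nat.cast_pow, Nat.cast_ofNat]
    generalize ∑ s, ‖signSum (fun i => z i.succ) s‖ ^ 4 = Q at *
    generalize ∑ i : Fin N, ‖z i.succ‖ ^ 2 = R at *
    rw [pow_succ (2 : ℝ)]
    nlinarith [this, hN]

end Rademacher

/-! ### Operators on `ℓ_∞^m` with values in a space of cotype 2 -/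

section Cotype

variable {X : Type*} [NormedAddCommGroup X] [NormedSpace ℂ X]

/-- A real supremum over an unbounded set is 0 by convention; boundedness makes `weakLpNorm` a
genuine upper bound. -/
theorem weakLpNorm_bddAbove {p : ℝ} (hp : 0 < p) {m : ℕ} (x : Fin m → X) :
    BddAbove (Set.range fun φ : {φ : StrongDual ℂ X // ‖φ‖ ≤ 1} =>
      (∑ i, ‖φ.1 (x i)‖ ^ p) ^ (1 / p)) := by
  refine ⟨(∑ i, ‖x i‖ ^ p) ^ (1 / p), ?_⟩
  rintro _ ⟨φ, rfl⟩
  dsimp only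
  gcongr with i
  exact φ.1.le_of_opNorm_le φ.2 (x i) |>.trans_eq (one_mul _)

theorem le_weakLpNorm {p : ℝ} (hp : 0 < p) {m : ℕ} (x : Fin m → X) (φ : StrongDual ℂ X)
    (hφ : ‖φ‖ ≤ 1) : (∑ i, ‖φ (x i)‖ ^ p) ^ (1 / p) ≤ weakLpNorm p x :=
  le_ciSup (weakLpNorm_bddAbove hp x) ⟨φ, hφ⟩

theorem weakLpNorm_le {p : ℝ} {m : ℕ} {x : Fin m → X} {B : ℝ}
    (h : ∀ φ : StrongDual ℂ X, ‖φ‖ ≤ 1 → (∑ i, ‖φ (x i)‖ ^ p) ^ (1 / p) ≤ B) :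
    weakLpNorm p x ≤ B :=
  have : Nonempty {φ : StrongDual ℂ X // ‖φ‖ ≤ 1} := ⟨⟨0, by simp⟩⟩
  ciSup_le fun φ => h φ.1 φ.2

theorem weakLpNorm_nonneg (p : ℝ) {m : ℕ} (x : Fin m → X) : 0 ≤ weakLpNorm p x :=
  Real.iSup_nonneg fun φ => by positivity

/-- `‖∑ aᵢ xᵢ‖ ≤ t w₁(x)` if `|aᵢ| ≤ t` for all `i`. -/
theorem norm_sum_smul_le_weakLpNorm_one {m : ℕ} (x : Fin m → X) {a : Fin m → ℂ} {t : ℝ}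
    (ht : 0 ≤ t) (ha : ∀ i, ‖a i‖ ≤ t) : ‖∑ i, a i • x i‖ ≤ t * weakLpNorm 1 x := by
  obtain ⟨φ, hφ, hv⟩ := exists_dual_vector'' ℂ (∑ i, a i • x i)
  have h1 := le_weakLpNorm one_pos x φ hφ
  simp only [Real.rpow_one, div_one] at h1
  calc ‖∑ i, a i • x i‖ = ‖φ (∑ i, a i • x i)‖ := by rw [hv]; simp
    _ ≤ ∑ i, ‖a i‖ * ‖φ (x i)‖ := by
        rw [map_sum]
        refine (norm_sum_le _ _).trans_eq (Finset.sum_congr rfl fun i _ => ?_)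
        rw [map_smul, norm_smul]
    _ ≤ ∑ i, t * ‖φ (x i)‖ := by gcongr with i; exact ha i
    _ ≤ t * weakLpNorm 1 x := by rw [← Finset.mul_sum]; gcongr

/-- The operator `a ↦ ∑ aᵢ xᵢ` on `ℓ_∞^m` is 2-summing, with `π₂² ≤ M`. -/
def TwoSummingBound {m : ℕ} (x : Fin m → X) (M : ℝ) : Prop :=
  ∀ (N : ℕ) (a : Fin N → Fin m → ℂ), (∀ i, ∑ k, ‖a k i‖ ^ 2 ≤ 1) →
    ∑ k, ‖∑ i, a k i • x i‖ ^ 2 ≤ M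

/-- Homogeneity, for an arbitrary finite index type. Since the proof divides by `√S`, it needs `0 <
S`. -/
theorem TwoSummingBound.sum_le {m : ℕ} {x : Fin m → X} {M : ℝ} (hM : TwoSummingBound x M)
    {κ : Type*} [Fintype κ] (a : κ → Fin m → ℂ) {S : ℝ} (hS : 0 < S)
    (ha : ∀ i, ∑ k, ‖a k i‖ ^ 2 ≤ S) : ∑ k, ‖∑ i, a k i • x i‖ ^ 2 ≤ M * S := by
  let e := Fintype.equivFin κ
  have hsq : (√S) ^ 2 = S := Real.sq_sqrt hS.le
  have hsp : 0 < √S := Real.sqrt_pos.2 hS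
  have hn : ‖((√S : ℝ) : ℂ)‖ = √S := by simp
  have h := hM (Fintype.card κ) (fun k i => ((√S : ℝ) : ℂ)⁻¹ * a (e.symm k) i) fun i => by
    rw [e.symm.sum_comp fun k => ‖((√S : ℝ) : ℂ)⁻¹ * a k i‖ ^ 2]
    simp only [norm_mul, norm_inv, hn, mul_pow, inv_pow, hsq, ← Finset.mul_sum]
    rw [inv_mul_le_iff₀ hS, mul_one]
    exact ha i
  rw [e.symm.sum_comp fun k => ‖∑ i, (((√S : ℝ) : ℂ)⁻¹ * a k i) • x i‖ ^ 2] at h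
  simp only [mul_smul, ← Finset.smul_sum, norm_smul, norm_inv, hn, mul_pow, inv_pow, hsq,
    ← Finset.mul_sum] at h
  rwa [inv_mul_le_iff₀ hS, mul_comm] at h

/-- A crude bound by Cauchy–Schwarz. It depends on `m` and serves only to start the iteration. -/
theorem twoSummingBound_of_finite {m : ℕ} (x : Fin m → X) :
    TwoSummingBound x (m * ∑ i, ‖x i‖ ^ 2) := by
  intro N a ha
  calc ∑ k, ‖∑ i, a k i • x i‖ ^ 2 ≤ ∑ k, (∑ i, ‖a k i‖ ^ 2) * ∑ i, ‖x i‖ ^ 2 := by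
        gcongr with k
        refine le_trans ?_ (Finset.sum_mul_sq_le_sq_mul_sq _ _ _)
        gcongr
        refine (norm_sum_le _ _).trans_eq (Finset.sum_congr rfl fun i _ => norm_smul _ _)
    _ = (∑ i, ∑ k, ‖a k i‖ ^ 2) * ∑ i, ‖x i‖ ^ 2 := by rw [← Finset.sum_mul, Finset.sum_comm]
    _ ≤ (∑ _i : Fin m, 1) * ∑ i, ‖x i‖ ^ 2 := by gcongr with i; exact ha i
    _ = _ := by simp

/-- The improvement of the 2-summing bound obtained by truncating Rademacher sums. -/
theorem TwoSummingBound.improve {C : ℝ} (hC : 0 < C)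
    (hX : ∀ (m : ℕ) (x : Fin m → X), ∑ i, ‖x i‖ ^ 2 ≤
      C ^ 2 * ((1 / 2 ^ m : ℝ) * ∑ s, ‖signSum x s‖ ^ 2))
    {m : ℕ} {x : Fin m → X} {M : ℝ} (hM : TwoSummingBound x M) :
    TwoSummingBound x (24 * C ^ 4 * weakLpNorm 1 x ^ 2 + M / 2) := by
  intro N a ha
  set W := weakLpNorm 1 x
  -- The truncation height. The final estimate is `C² (2 t² W² + 6 M / t²)`, and `t² = 12 C²` turns
  -- the coefficient of `M` into `1/2`.
  set t : ℝ := √12 * C with ht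
  have ht0 : 0 < t := by positivity
  have ht2 : t ^ 2 = 12 * C ^ 2 := by rw [ht, mul_pow, Real.sq_sqrt (by norm_num)]
  let f : (Fin N → Bool) → Fin m → ℂ := fun s i => signSum (fun k => a k i) s
  let g : (Fin N → Bool) → Fin m → ℂ := fun s i => if ‖f s i‖ ≤ t then f s i else 0
  let h : (Fin N → Bool) → Fin m → ℂ := fun s i => if ‖f s i‖ ≤ t then 0 else f s i
  have hfs : ∀ s, signSum (fun k => ∑ i, a k i • x i) s =
      ∑ i, g s i • x i + ∑ i, h s i • x i := fun s => by
    rw [← Finset.sum_add_distrib]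
    have h1 : ∀ i, g s i • x i + h s i • x i = f s i • x i := fun i => by
      simp only [g, h]; split_ifs <;> simp
    simp only [h1, f, signSum, Finset.sum_smul]
    rw [Finset.sum_comm]
    refine Finset.sum_congr rfl fun k _ => ?_
    split_ifs <;> simp
  have hg : ∀ s, ‖∑ i, g s i • x i‖ ≤ t * W := fun s =>
    norm_sum_smul_le_weakLpNorm_one x ht0.le fun i => by
      simp only [g]; split_ifs with h1
      · exact h1
      · simpa using ht0.le
  -- The vectors `h s`, indexed by all sign choices, form a test family for the assumed bound: where
  -- `|f| > t` one has `|f|² ≤ |f|⁴ / t²`, and the fourth moment is at most `3 · 2 ^ N`.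
  have hh : ∑ s, ‖∑ i, h s i • x i‖ ^ 2 ≤ M * (2 ^ N * 3 / t ^ 2) := by
    refine hM.sum_le h (by positivity) fun i => ?_
    have h1 : ∀ s, ‖h s i‖ ^ 2 ≤ ‖f s i‖ ^ 4 / t ^ 2 := fun s => by
      simp only [h]; split_ifs with h2
      · simp; positivity
      · rw [le_div_iff₀ (by positivity)]
        push Not at h2
        nlinarith [pow_le_pow_left₀ ht0.le h2.le 2, sq_nonneg ‖f s i‖]
    refine (Finset.sum_le_sum fun s _ => h1 s).trans ?_
    rw [← Finset.sum_div]
    gcongr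
    refine (sum_norm_signSum_pow_four_le _).trans ?_
    gcongr
    have h0 : 0 ≤ ∑ k, ‖a k i‖ ^ 2 := by positivity
    nlinarith [ha i]
  have hsum : ∑ s, ‖signSum (fun k => ∑ i, a k i • x i) s‖ ^ 2 ≤
      2 ^ N * (2 * (t * W) ^ 2) + 2 * (M * (2 ^ N * 3 / t ^ 2)) := by
    calc _ ≤ ∑ s : Fin N → Bool, (2 * (t * W) ^ 2 + 2 * ‖∑ i, h s i • x i‖ ^ 2) := by
          refine Finset.sum_le_sum fun s _ => ?_
          rw [hfs]
          have h1 := norm_add_le (∑ i, g s i • x i) (∑ i, h s i • x i)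
          have h2 := pow_le_pow_left₀ (norm_nonneg _) h1 2
          have h3 := pow_le_pow_left₀ (norm_nonneg _) (hg s) 2
          nlinarith [sq_nonneg (‖∑ i, g s i • x i‖ - ‖∑ i, h s i • x i‖)]
      _ ≤ _ := by
          rw [Finset.sum_add_distrib]
          simp only [Finset.sum_const, Finset.card_univ, Fintype.card_fun, Fintype.card_bool,
            Fintype.card_fin, nsmul_eq_mul, Nat.cast_pow, Nat.cast_ofNat]
          rw [← Finset.mul_sum]
          gcongr
  refine (hX N _).trans ?_
  calc _ ≤ C ^ 2 * ((1 / 2 ^ N : ℝ) *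
        (2 ^ N * (2 * (t * W) ^ 2) + 2 * (M * (2 ^ N * 3 / t ^ 2)))) := by gcongr
    _ = _ := by rw [mul_pow, ht2]; field_simp; ring

/-- The map `M ↦ A + M/2` contracts to its fixed point `2A`, so the dependence on `m` in the
starting bound disappears in the limit. -/
theorem twoSummingBound_of_cotype {C : ℝ} (hC : 0 < C)
    (hX : ∀ (m : ℕ) (x : Fin m → X), ∑ i, ‖x i‖ ^ 2 ≤
      C ^ 2 * ((1 / 2 ^ m : ℝ) * ∑ s, ‖signSum x s‖ ^ 2))
    {m : ℕ} (x : Fin m → X) : TwoSummingBound x (48 * C ^ 4 * weakLpNorm 1 x ^ 2) := by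
  set A := 24 * C ^ 4 * weakLpNorm 1 x ^ 2 with hA
  have h : ∀ j : ℕ, TwoSummingBound x (2 * A + (m * ∑ i, ‖x i‖ ^ 2) * (1 / 2) ^ j) := by
    intro j
    induction j with
    | zero =>
      intro N a ha
      have : 0 ≤ A := by positivity
      linarith [twoSummingBound_of_finite x N a ha]
    | succ j ih =>
      convert! ih.improve hC hX using 1
      rw [← hA]; ring
  intro N a ha
  have hlim : Tendsto (fun j : ℕ => 2 * A + (m * ∑ i, ‖x i‖ ^ 2) * (1 / 2 : ℝ) ^ j) atTop
      (𝓝 (2 * A + (m * ∑ i, ‖x i‖ ^ 2) * 0)) :=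
    ((tendsto_pow_atTop_nhds_zero_of_lt_one (by norm_num) (by norm_num)).const_mul _).const_add _
  refine (ge_of_tendsto' hlim fun j => h j N a ha).trans_eq ?_
  rw [hA]; ring

/-- Pietsch domination on `ℓ_∞^m`. -/
theorem TwoSummingBound.exists_weights {m : ℕ} [Nonempty (Fin m)] {x : Fin m → X} {M : ℝ}
    (hM : TwoSummingBound x M) : ∃ μ : Fin m → ℝ, (∀ i, 0 ≤ μ i) ∧ ∑ i, μ i = 1 ∧
      ∀ a : Fin m → ℂ, ‖∑ i, a i • x i‖ ^ 2 ≤ M * ∑ i, μ i * ‖a i‖ ^ 2 := by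
  let G : (Fin m → ℂ) → Fin m → ℝ := fun a i => M * ‖a i‖ ^ 2 - ‖∑ i, a i • x i‖ ^ 2
  let O : Set (Fin m → ℝ) := Set.pi Set.univ fun _ => Set.Iio 0
  have hO : ∀ v, v ∈ O ↔ ∀ i, v i < 0 := fun v => by simp [O]
  have hM0 : 0 ≤ M := by simpa using hM 0 (fun _ _ => 0) (by simp)
  -- A convex combination of functions `G a` has the form `M ∑ |b_k(i)|² - ∑ ‖u(b_k)‖²` with `b_k =
  -- √w_k a_k`. At a coordinate maximizing `∑ |b_k(i)|²` it is nonnegative, by the 2-summing bound.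
  have hdisj : Disjoint O (convexHull ℝ (Set.range G)) := by
    rw [Set.disjoint_left]
    intro v hv hc
    rw [hO] at hv
    obtain ⟨κ, _, w, z, hw, -, hz, rfl⟩ := mem_convexHull_iff_exists_fintype.1 hc
    choose a ha using hz
    let b : κ → Fin m → ℂ := fun k i => ((√(w k) : ℝ) : ℂ) * a k i
    have hn : ∀ k, ‖((√(w k) : ℝ) : ℂ)‖ ^ 2 = w k := fun k => by
      rw [Complex.norm_real, Real.norm_eq_abs, sq_abs, Real.sq_sqrt (hw k)]
    have hb : ∀ k i, ‖b k i‖ ^ 2 = w k * ‖a k i‖ ^ 2 := fun k i => by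
      rw [norm_mul, mul_pow, hn]
    have hb' : ∀ k, ‖∑ i, b k i • x i‖ ^ 2 = w k * ‖∑ i, a k i • x i‖ ^ 2 := fun k => by
      simp only [b, mul_smul, ← Finset.smul_sum]
      rw [norm_smul, mul_pow, hn]
    have hval : ∀ i, (∑ k, w k • z k) i = M * ∑ k, ‖b k i‖ ^ 2 - ∑ k, ‖∑ i, b k i • x i‖ ^ 2 := by
      intro i
      simp only [Finset.sum_apply, Pi.smul_apply, smul_eq_mul, ← ha, G, hb, hb', Finset.mul_sum,
        ← Finset.sum_sub_distrib]
      exact Finset.sum_congr rfl fun k _ => by ring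
    obtain ⟨i₀, -, hi₀⟩ := Finset.exists_max_image Finset.univ (fun i => ∑ k, ‖b k i‖ ^ 2)
      Finset.univ_nonempty
    have hneg := hv i₀
    rw [hval] at hneg
    have hle : ∑ k, ‖∑ i, b k i • x i‖ ^ 2 ≤ M * ∑ k, ‖b k i₀‖ ^ 2 := by
      refine le_of_forall_pos_le_add fun ε hε => ?_
      -- The maximum may be 0, whereas `sum_le` needs a positive bound.
      have hδ : 0 < ε / (M + 1) := by positivity
      refine (hM.sum_le b (S := ∑ k, ‖b k i₀‖ ^ 2 + ε / (M + 1)) (by positivity)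
        fun i => (hi₀ i (Finset.mem_univ i)).trans (by linarith)).trans ?_
      rw [mul_add]
      gcongr
      rw [mul_div_assoc', div_le_iff₀ (by positivity)]
      nlinarith
    linarith
  have hOc : Convex ℝ O := convex_pi fun _ _ => convex_Iio 0
  have hOo : IsOpen O := isOpen_set_pi Set.finite_univ fun _ _ => isOpen_Iio
  obtain ⟨f, c, hf1, hf2⟩ := geometric_hahn_banach_open hOc hOo (convex_convexHull ℝ _) hdisj
  have hc0 : c ≤ 0 := by
    have := hf2 0 (subset_convexHull ℝ _ ⟨0, by ext i; simp [G]⟩)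
    simpa using this
  -- The separating functional is positive: if `f v < 0` with `v ≥ 0`, then `-(v + ε • 1)` lies in
  -- `O`, but for small `ε` its value under `f` is positive and exceeds `c ≤ 0`.
  have hfle : ∀ v : Fin m → ℝ, (∀ i, 0 ≤ v i) → 0 ≤ f v := by
    intro v hv
    by_contra! hneg
    obtain ⟨ε, hε, hε'⟩ : ∃ ε > 0, ε * f 1 < - f v := by
      refine ⟨-f v / (2 * (|f 1| + 1)), div_pos (by linarith) (by positivity), ?_⟩
      rw [div_mul_eq_mul_div, div_lt_iff₀ (by positivity)]
      nlinarith [le_abs_self (f 1), abs_nonneg (f 1)]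
    have h1 := hf1 (-(v + ε • 1)) (by
      rw [hO]; intro i
      simp only [Pi.neg_apply, Pi.add_apply, Pi.smul_apply, Pi.one_apply, smul_eq_mul, mul_one]
      linarith [hv i])
    simp only [map_neg, map_add, map_smul, smul_eq_mul] at h1
    linarith
  -- The origin is a limit of the points `-(ε • 1)` of `O`.
  have hc : 0 ≤ c := by
    have hlim : Tendsto (fun ε : ℝ => f (-(ε • 1))) (𝓝[>] 0) (𝓝 (f (-((0 : ℝ) • 1)))) :=
      Tendsto.mono_left (Continuous.tendsto (by fun_prop) 0) nhdsWithin_le_nhds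
    have := le_of_tendsto hlim (eventually_nhdsWithin_of_forall fun ε (hε : 0 < ε) =>
      (hf1 (-(ε • 1)) (by rw [hO]; intro i; simpa using hε)).le)
    simpa using this
  have hf_one : 0 < f 1 := by
    have := hf1 (-1) (by rw [hO]; intro i; simp)
    rw [map_neg] at this
    linarith
  let ν : Fin m → ℝ := fun i => f (Pi.single i 1)
  have hν : ∀ v, f v = ∑ i, ν i * v i := fun v => by
    conv_lhs => rw [pi_eq_sum_univ' v]
    rw [map_sum]
    refine Finset.sum_congr rfl fun i _ => ?_
    rw [map_smul, smul_eq_mul, mul_comm]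
  have hν1 : ∑ i, ν i = f 1 := by simp [hν]
  refine ⟨fun i => ν i / f 1, fun i => div_nonneg (hfle _ fun j => ?_) hf_one.le, ?_, fun a => ?_⟩
  · by_cases h : j = i
    · subst h; simp
    · simp [h]
  · rw [← Finset.sum_div, hν1, div_self hf_one.ne']
  · have h := hc.trans (hf2 (G a) (subset_convexHull ℝ _ ⟨a, rfl⟩))
    rw [hν] at h
    simp only [G, mul_sub, Finset.sum_sub_distrib, ← Finset.sum_mul, hν1] at h
    simp only [div_mul_eq_mul_div, ← Finset.sum_div]
    rw [mul_div_assoc', le_div_iff₀ hf_one, Finset.mul_sum]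
    have h2 : ∑ i, ν i * (M * ‖a i‖ ^ 2) = ∑ i, M * (ν i * ‖a i‖ ^ 2) :=
      Finset.sum_congr rfl fun i _ => by ring
    rw [h2] at h
    linarith

/-- In a space of cotype 2, every finite sequence splits as `xᵢ = λᵢ yᵢ` with `‖λ‖₂ ≤ 1` and
`w₂(y) ≤ K w₁(x)`. -/
theorem HasCotypeTwo.exists_factorization (hX : HasCotypeTwo X) :
    ∃ K > 0, ∀ (m : ℕ) (x : Fin m → X), ∃ (l : Fin m → ℝ) (y : Fin m → X),
      (∀ i, 0 ≤ l i) ∧ ∑ i, l i ^ 2 ≤ 1 ∧ (∀ i, x i = ((l i : ℝ) : ℂ) • y i) ∧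
        weakLpNorm 2 y ≤ K * weakLpNorm 1 x := by
  obtain ⟨C₀, hC₀, hC₀X⟩ := hX
  set C := C₀ + 1
  have hC : 0 < C := by positivity
  have hCX : ∀ (m : ℕ) (x : Fin m → X), ∑ i, ‖x i‖ ^ 2 ≤
      C ^ 2 * ((1 / 2 ^ m : ℝ) * ∑ s, ‖signSum x s‖ ^ 2) := by
    intro m x
    have h := pow_le_pow_left₀ (Real.sqrt_nonneg _) (hC₀X m x) 2
    rw [mul_pow, Real.sq_sqrt (by positivity), Real.sq_sqrt (by positivity)] at h
    refine h.trans ?_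
    simp only [signSum]
    gcongr
    simp [C]
  refine ⟨√48 * C ^ 2, by positivity, fun m x => ?_⟩
  -- The empty index set carries no probability.
  rcases isEmpty_or_nonempty (Fin m) with hm | hm
  · refine ⟨fun _ => 0, x, by simp, by simp, fun i => hm.elim i, weakLpNorm_le fun φ _ => ?_⟩
    have := weakLpNorm_nonneg 1 x
    simp
    positivity
  obtain ⟨μ, hμ0, hμ1, hμ⟩ := (twoSummingBound_of_cotype hC hCX x).exists_weights
  set W := weakLpNorm 1 x with hW
  have hW0 : 0 ≤ W := weakLpNorm_nonneg 1 x
  -- Domination tested on the unit vector `e_i`. Coordinates without mass can thus be ignored when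
  -- dividing by `√μ`.
  have hzero : ∀ i, μ i = 0 → x i = 0 := fun i hi => by
    have := hμ (Pi.single i 1)
    simp only [Pi.single_apply, ite_smul, one_smul, zero_smul, Finset.sum_ite_eq',
      Finset.mem_univ, if_true] at this
    have h2 : ∑ j, μ j * ‖if j = i then (1 : ℂ) else 0‖ ^ 2 = 0 :=
      Finset.sum_eq_zero fun j _ => by
        split_ifs with h
        · rw [h, hi, zero_mul]
        · simp
    rw [h2, mul_zero] at this
    simpa using this
  have hsq : ∀ i, √(μ i) ^ 2 = μ i := fun i => Real.sq_sqrt (hμ0 i)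
  refine ⟨fun i => √(μ i), fun i => ((√(μ i) : ℝ) : ℂ)⁻¹ • x i, fun i => Real.sqrt_nonneg _,
    by simp only [hsq, hμ1, le_refl], fun i => ?_, weakLpNorm_le fun φ hφ => ?_⟩
  · by_cases hi : μ i = 0
    · simp [hzero i hi]
    · have : ((√(μ i) : ℝ) : ℂ) ≠ 0 := by
        rw [Complex.ofReal_ne_zero, Real.sqrt_ne_zero (hμ0 i)]; exact hi
      rw [smul_inv_smul₀ this]
  set y : Fin m → X := fun i => ((√(μ i) : ℝ) : ℂ)⁻¹ • x i with hy
  set s := ∑ i, ‖φ (y i)‖ ^ 2 with hs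
  have hs0 : 0 ≤ s := by positivity
  have hss : ∑ i, ‖φ (y i)‖ ^ (2 : ℝ) = s := by simp [hs]
  change (∑ i, ‖φ (y i)‖ ^ (2 : ℝ)) ^ (1 / 2 : ℝ) ≤ _
  rw [hss, ← Real.sqrt_eq_rpow]
  -- Chosen so that `φ(u(a)) = s` while `∑ μ_i |a_i|² ≤ s`. Domination then reads `s² ≤ 48 C⁴ W² s`,
  -- and one factor `s` cancels.
  let a : Fin m → ℂ := fun i => (starRingEnd ℂ) (φ (y i)) * ((√(μ i) : ℝ) : ℂ)⁻¹
  have h1 : φ (∑ i, a i • x i) = (s : ℂ) := by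
    rw [map_sum, hs, Complex.ofReal_sum]
    refine Finset.sum_congr rfl fun i _ => ?_
    rw [map_smul, smul_eq_mul]
    simp only [a, mul_assoc]
    rw [← smul_eq_mul (_⁻¹) (φ (x i)), ← map_smul, ← Complex.normSq_eq_conj_mul_self,
      Complex.normSq_eq_norm_sq]
  have h2 : s ≤ ‖∑ i, a i • x i‖ := by
    have := φ.le_of_opNorm_le hφ (∑ i, a i • x i)
    rw [h1, one_mul, Complex.norm_real, Real.norm_of_nonneg hs0] at this
    exact this
  have h3 : ∑ i, μ i * ‖a i‖ ^ 2 ≤ s := by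
    refine Finset.sum_le_sum fun i _ => ?_
    simp only [a, norm_mul, norm_inv, mul_pow, inv_pow, Complex.norm_real, RCLike.norm_conj,
      Real.norm_eq_abs, sq_abs, hsq]
    rcases (hμ0 i).eq_or_lt with h | h
    · rw [← h]; simp
    · rw [mul_left_comm, mul_inv_cancel₀ h.ne', mul_one]
  have h4 : s ^ 2 ≤ 48 * C ^ 4 * W ^ 2 * s :=
    (pow_le_pow_left₀ hs0 h2 2).trans ((hμ a).trans (by gcongr))
  have h5 : s ≤ 48 * C ^ 4 * W ^ 2 := by
    rcases hs0.eq_or_lt with h | h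
    · rw [← h]; positivity
    · exact le_of_mul_le_mul_right (by rwa [← sq]) h
  refine Real.sqrt_le_iff.2 ⟨by positivity, h5.trans_eq ?_⟩
  rw [mul_pow, mul_pow, Real.sq_sqrt (by norm_num)]
  ring

end Cotype

/-! ### Norms of sequences in Köthe spaces -/

namespace KotheSpace

section SeqNorm

variable {E : KotheSpace}

theorem seqNorm_of_mem {x : ℕ → ℂ} (h : x ∈ E.toSubmodule) : E.seqNorm x = E.nrm ⟨x, h⟩ := dif_pos h

theorem seqNorm_seq (x : E.Space) : E.seqNorm x.seq = ‖x‖ := seqNorm_of_mem x.2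

theorem seqNorm_nonneg (x : ℕ → ℂ) : 0 ≤ E.seqNorm x := by
  unfold seqNorm
  split_ifs with h
  · exact (norm_nonneg _).trans (E.le_linf ⟨x, h⟩ 0)
  · exact le_rfl

theorem norm_apply_le_seqNorm {x : ℕ → ℂ} (h : x ∈ E.toSubmodule) (k : ℕ) :
    ‖x k‖ ≤ E.seqNorm x := by
  rw [seqNorm_of_mem h]
  exact E.le_linf ⟨x, h⟩ k

theorem mem_and_seqNorm_le {x y : ℕ → ℂ} (hy : y ∈ E.toSubmodule) (h : ∀ k, ‖x k‖ ≤ ‖y k‖) :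
    x ∈ E.toSubmodule ∧ E.seqNorm x ≤ E.seqNorm y := by
  obtain ⟨hx, hle⟩ := E.normal x ⟨y, hy⟩ h
  exact ⟨hx, by rwa [seqNorm_of_mem hx, seqNorm_of_mem hy]⟩

theorem seqNorm_smul {x : ℕ → ℂ} (hx : x ∈ E.toSubmodule) (c : ℂ) :
    E.seqNorm (c • x) = ‖c‖ * E.seqNorm x := by
  rw [seqNorm_of_mem hx, seqNorm_of_mem (E.toSubmodule.smul_mem c hx)]
  exact E.nrm_smul c ⟨x, hx⟩

theorem seqNorm_sum_le {ι : Type*} (s : Finset ι) {x : ι → ℕ → ℂ}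
    (hx : ∀ j, x j ∈ E.toSubmodule) : E.seqNorm (∑ j ∈ s, x j) ≤ ∑ j ∈ s, E.seqNorm (x j) := by
  classical
  induction s using Finset.induction_on with
  | empty =>
    rw [Finset.sum_empty, Finset.sum_empty, seqNorm_of_mem E.toSubmodule.zero_mem]
    exact E.nrm_zero.le
  | insert a s ha ih =>
    rw [Finset.sum_insert ha, Finset.sum_insert ha]
    have hs : ∑ j ∈ s, x j ∈ E.toSubmodule := E.toSubmodule.sum_mem fun j _ => hx j
    refine le_trans ?_ (add_le_add_right ih _)
    rw [seqNorm_of_mem (E.toSubmodule.add_mem (hx a) hs), seqNorm_of_mem (hx a),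
      seqNorm_of_mem hs]
    exact E.nrm_add_le ⟨_, hx a⟩ ⟨_, hs⟩

theorem norm_extendZero {m : ℕ} {a : Fin m → ℝ} (ha : ∀ i, 0 ≤ a i) (k : ℕ) :
    ‖extendZero a k‖ = if h : k < m then a ⟨k, h⟩ else 0 := by
  unfold extendZero
  split_ifs with h
  · simp [abs_of_nonneg (ha _)]
  · simp

theorem extendZero_mem (E : KotheSpace) {m : ℕ} (a : Fin m → ℝ) :
    extendZero a ∈ E.toSubmodule := by
  refine (E.of_l1 _ (summable_of_ne_finset_zero (s := Finset.range m) fun k hk => ?_)).1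
  simp only [Finset.mem_range] at hk
  simp [extendZero, hk]

end SeqNorm

/-! ### The spaces `ℓ_n(𝓛; G, E)` -/

section EllN

variable {n : ℕ} {G E : KotheSpace}

/-- Multilinearity of a diagonal map is automatic coordinatewise; only values in `E` and the norm
bound have to be supplied. -/
theorem exists_diagonal_of_bound {α : ℕ → ℂ} {B : ℝ} (hB : 0 ≤ B)
    (h : ∀ x : Fin n → G.Space, (fun k => α k * ∏ j, (x j).seq k) ∈ E.toSubmodule ∧
      E.seqNorm (fun k => α k * ∏ j, (x j).seq k) ≤ B * ∏ j, ‖x j‖) :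
    ∃ S : ContinuousMultilinearMap ℂ (fun _ : Fin n => G.Space) E.Space,
      IsDiagonal α S ∧ ‖S‖ ≤ B := by
  have key : ∀ x : Fin n → G.Space, ∃ y : E.Space, ‖y‖ ≤ B * ∏ j, ‖x j‖ ∧
      ∀ k, y.seq k = α k * ∏ j, (x j).seq k := fun x =>
    ⟨⟨_, (h x).1⟩, (seqNorm_of_mem (h x).1).symm.trans_le (h x).2, fun k => rfl⟩
  choose f hf hfs using key
  have hupd : ∀ (x : Fin n → G.Space) (i : Fin n) (k : ℕ) (c : G.Space),
      ∏ j, (Function.update x i c j).seq k =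
        c.seq k * ∏ j ∈ Finset.univ \ {i}, (x j).seq k := fun x i k c => by
    rw [← Finset.prod_update_of_mem (Finset.mem_univ i)]
    refine Finset.prod_congr rfl fun j _ => ?_
    by_cases hj : j = i
    · subst hj; simp
    · simp [hj]
  let L : MultilinearMap ℂ (fun _ : Fin n => G.Space) E.Space :=
    { toFun := f
      map_update_add' := fun {dec} x i a b => Space.ext (funext fun k => by
        obtain rfl : dec = instDecidableEqFin n := Subsingleton.elim _ _
        have h1 : ∀ u v : E.Space, (u + v).seq k = u.seq k + v.seq k := fun _ _ => rfl
        have h2 : (a + b).seq k = a.seq k + b.seq k := rfl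
        rw [h1, hfs, hfs, hfs, hupd, hupd, hupd, h2]
        ring)
      map_update_smul' := fun {dec} x i c a => Space.ext (funext fun k => by
        obtain rfl : dec = instDecidableEqFin n := Subsingleton.elim _ _
        have h1 : ∀ u : E.Space, (c • u).seq k = c * u.seq k := fun _ => rfl
        have h2 : (c • a).seq k = c * a.seq k := rfl
        rw [h1, hfs, hfs, hupd, hupd, h2]
        ring) }
  exact ⟨L.mkContinuous _ hf, fun x k => hfs x k, L.mkContinuous_norm_le hB hf⟩

/-- The norm of `ellN` is that of a chosen operator. A diagonal operator is determined by its
symbol, so any witness computes it. -/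
theorem ellN_mem_and_seqNorm_le {α : ℕ → ℂ} {B : ℝ} (hB : 0 ≤ B)
    (h : ∀ x : Fin n → G.Space, (fun k => α k * ∏ j, (x j).seq k) ∈ E.toSubmodule ∧
      E.seqNorm (fun k => α k * ∏ j, (x j).seq k) ≤ B * ∏ j, ‖x j‖) :
    α ∈ (ellN n G E).toSubmodule ∧ (ellN n G E).seqNorm α ≤ B := by
  obtain ⟨S, hS, hn⟩ := exists_diagonal_of_bound hB h
  have hm : α ∈ (ellN n G E).toSubmodule := ⟨hS.bdd, S, hS⟩
  refine ⟨hm, ?_⟩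
  rw [seqNorm_of_mem hm]
  have : hm.2.choose = S := hm.2.choose_spec.unique hS
  exact (congrArg norm this).trans_le hn

theorem seqNorm_mul_prod_le {α : ℕ → ℂ} (hα : α ∈ (ellN n G E).toSubmodule)
    (x : Fin n → G.Space) :
    E.seqNorm (fun k => α k * ∏ j, (x j).seq k) ≤ (ellN n G E).seqNorm α * ∏ j, ‖x j‖ := by
  have h1 : (fun k => α k * ∏ j, (x j).seq k) = (hα.2.choose x).seq :=
    funext fun k => (hα.2.choose_spec x k).symm
  rw [h1, seqNorm_seq, seqNorm_of_mem hα]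
  exact hα.2.choose.le_opNorm x

end EllN

/-! ### The inclusions `ℓ_p ↪ E^{1/n}` -/

section Inclusion

variable {n : ℕ} {E : KotheSpace} {p q r : ℝ}

theorem LpBound.seqNorm_pow_le {C : ℝ} (hn : 1 ≤ n) (h : E.LpBound n p C)
    {x : ℕ → ℂ} (hx : Summable fun k => ‖x k‖ ^ p) :
    E.seqNorm (fun k => ((‖x k‖ ^ n : ℝ) : ℂ)) ≤ (C * (∑' k, ‖x k‖ ^ p) ^ (1 / p)) ^ n := by
  have h1 := (h x hx).2
  have hn0 : n ≠ 0 := by omega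
  have h2 := pow_le_pow_left₀ (Real.rpow_nonneg (seqNorm_nonneg _) _) h1 n
  rwa [one_div, Real.rpow_inv_natCast_pow (seqNorm_nonneg _) hn0] at h2

/-- Tested on a unit vector. It makes the inclusion norms positive, so that they may be inverted and
cancelled. -/
theorem one_le_of_lpBound {C : ℝ} (hn : 1 ≤ n) (hp : 0 < p) (h : E.LpBound n p C) : 1 ≤ C := by
  let e : ℕ → ℂ := Pi.single 0 1
  have he : ∀ k ≠ 0, ‖e k‖ ^ p = 0 := fun k hk => by simp [e, hk, hp.ne']
  have hs : HasSum (fun k => ‖e k‖ ^ p) 1 := by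
    have := hasSum_single 0 he
    simpa [e] using this
  have h2 := (h e hs.summable).2
  rw [hs.tsum_eq, Real.one_rpow, mul_one, rootNorm] at h2
  refine le_trans (Real.one_le_rpow ?_ (by positivity)) h2
  have := norm_apply_le_seqNorm (h e hs.summable).1.2 0
  simpa [e] using this

theorem LpEmbeds.one_le_inclNorm (hn : 1 ≤ n) (hp : 0 < p) (h : E.LpEmbeds n p) :
    1 ≤ E.inclNorm n p :=
  le_csInf h fun _ hC => one_le_of_lpBound hn hp hC.2

theorem inclNorm_nonneg (E : KotheSpace) (n : ℕ) (p : ℝ) : 0 ≤ E.inclNorm n p :=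
  Real.sInf_nonneg fun _ h => h.1

/-- From `|x|^n ≤ ‖x‖₁^(n-1) |x|`, the `ℓ₁` norm of `|x|^n` is at most `‖x‖₁^n`. -/
theorem lpEmbeds_one (E : KotheSpace) (hn : 1 ≤ n) : E.LpEmbeds n 1 := by
  refine ⟨1, zero_le_one, fun x hx => ?_⟩
  simp only [Real.rpow_one, div_one, one_mul] at hx ⊢
  set S := ∑' k, ‖x k‖ with hS
  have hS0 : 0 ≤ S := tsum_nonneg fun k => norm_nonneg _
  have hk : ∀ k, ‖x k‖ ≤ S := fun k => hx.le_tsum k fun _ _ => norm_nonneg _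
  have hle : ∀ k, ‖((‖x k‖ ^ n : ℝ) : ℂ)‖ ≤ S ^ (n - 1) * ‖x k‖ := fun k => by
    rw [Complex.norm_real, Real.norm_of_nonneg (by positivity), ← pow_sub_one_mul (by omega)]
    gcongr
    exact hk k
  have hs : Summable fun k => ‖((‖x k‖ ^ n : ℝ) : ℂ)‖ :=
    Summable.of_nonneg_of_le (fun k => norm_nonneg _) hle (hx.mul_left _)
  obtain ⟨hm, hn'⟩ := E.of_l1 _ hs
  refine ⟨⟨⟨S, by rintro _ ⟨k, rfl⟩; exact hk k⟩, hm⟩, ?_⟩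
  have h1 : E.seqNorm (fun k => ((‖x k‖ ^ n : ℝ) : ℂ)) ≤ S ^ n := by
    rw [seqNorm_of_mem hm]
    refine hn'.trans ((hs.tsum_le_tsum hle (hx.mul_left _)).trans_eq ?_)
    rw [tsum_mul_left, ← hS, pow_sub_one_mul (by omega)]
  calc E.rootNorm n x ≤ (S ^ n) ^ (1 / (n : ℝ)) :=
        Real.rpow_le_rpow (seqNorm_nonneg _) h1 (by positivity)
    _ = S := by rw [one_div, Real.pow_rpow_inv_natCast hS0 (by omega)]

/-- A crude arithmetic–geometric mean inequality. The lost factor `n` is harmless, as it enters only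
the continuity of an inclusion. -/
theorem prod_le_sum_pow (hn : 1 ≤ n) {a : Fin n → ℝ} (ha : ∀ j, 0 ≤ a j) :
    ∏ j, a j ≤ ∑ j, a j ^ n := by
  have : Nonempty (Fin n) := ⟨⟨0, hn⟩⟩
  obtain ⟨j₀, -, h⟩ := Finset.exists_max_image Finset.univ a Finset.univ_nonempty
  calc ∏ j, a j ≤ ∏ _j : Fin n, a j₀ := Finset.prod_le_prod (fun j _ => ha j) h
    _ = a j₀ ^ n := by simp
    _ ≤ ∑ j, a j ^ n :=
        Finset.single_le_sum (f := fun j => a j ^ n) (fun j _ => pow_nonneg (ha j) n)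
          (Finset.mem_univ j₀)

/-- If `ℓ_p ↪ E^{1/n}`, then products of `n` elements of `ℓ_p` belong to `E`. -/
theorem LpBound.prod_mem_and_seqNorm_le {C : ℝ} (hn : 1 ≤ n) (hp : 1 ≤ p)
    (h : E.LpBound n p C) (y : Fin n → ℕ → ℂ) (hy : ∀ j, Summable fun k => ‖y j k‖ ^ p) :
    (fun k => ∏ j, y j k) ∈ E.toSubmodule ∧
      E.seqNorm (fun k => ∏ j, y j k) ≤
        n * C ^ n * ∏ j, (∑' k, ‖y j k‖ ^ p) ^ (1 / p) := by
  have hp0 : 0 < p := by linarith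
  set R : Fin n → ℝ := fun j => (∑' k, ‖y j k‖ ^ p) ^ (1 / p) with hR
  have hT0 : ∀ j, 0 ≤ ∑' k, ‖y j k‖ ^ p := fun j => tsum_nonneg fun k => by positivity
  have hR0 : ∀ j, 0 ≤ R j := fun j => Real.rpow_nonneg (hT0 j) _
  have hRp : ∀ j, R j ^ p = ∑' k, ‖y j k‖ ^ p := fun j => by
    rw [hR]
    dsimp only
    rw [← Real.rpow_mul (hT0 j), one_div_mul_cancel hp0.ne', Real.rpow_one]
  have hyR : ∀ j k, ‖y j k‖ ≤ R j := fun j k => by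
    refine (Real.rpow_le_rpow_iff (norm_nonneg _) (hR0 j) hp0).1 ?_
    rw [hRp]
    exact (hy j).le_tsum k fun _ _ => by positivity
  by_cases hz : ∃ j, R j = 0
  · obtain ⟨j, hj⟩ := hz
    have h0 : (fun k => ∏ j, y j k) = 0 := funext fun k =>
      Finset.prod_eq_zero (Finset.mem_univ j) (norm_le_zero_iff.1 (hj ▸ hyR j k))
    rw [h0, Finset.prod_eq_zero (Finset.mem_univ j) hj, mul_zero,
      seqNorm_of_mem E.toSubmodule.zero_mem]
    exact ⟨E.toSubmodule.zero_mem, E.nrm_zero.le⟩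
  push Not at hz
  have hRpos : ∀ j, 0 < R j := fun j => (hR0 j).lt_of_ne (hz j).symm
  -- Normalizing every factor in `ℓ_p` before replacing the product by a sum of `n`-th powers makes
  -- the final bound a multiple of `∏ R j`.
  let w : Fin n → ℕ → ℂ := fun j k => ((R j : ℝ) : ℂ)⁻¹ * y j k
  have hw : ∀ j k, ‖w j k‖ = (R j)⁻¹ * ‖y j k‖ := fun j k => by
    rw [norm_mul, norm_inv, Complex.norm_real, Real.norm_of_nonneg (hR0 j)]
  have hwp : ∀ j k, ‖w j k‖ ^ p = (R j ^ p)⁻¹ * ‖y j k‖ ^ p := fun j k => by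
    rw [hw, Real.mul_rpow (inv_nonneg.2 (hR0 j)) (norm_nonneg _), Real.inv_rpow (hR0 j)]
  have hws : ∀ j, Summable fun k => ‖w j k‖ ^ p := fun j => by
    simp only [hwp]
    exact (hy j).mul_left _
  have hw1 : ∀ j, ∑' k, ‖w j k‖ ^ p = 1 := fun j => by
    simp only [hwp]
    rw [tsum_mul_left, ← hRp, inv_mul_cancel₀ (Real.rpow_pos_of_pos (hRpos j) p).ne']
  let v : Fin n → ℕ → ℂ := fun j k => ((‖w j k‖ ^ n : ℝ) : ℂ)
  have hv : ∀ j, v j ∈ E.toSubmodule := fun j => (h (w j) (hws j)).1.2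
  have hvn : ∀ j, E.seqNorm (v j) ≤ C ^ n := fun j => by
    have := h.seqNorm_pow_le hn (hws j)
    rwa [hw1, Real.one_rpow, mul_one] at this
  have hsum : ∑ j, v j ∈ E.toSubmodule := E.toSubmodule.sum_mem fun j _ => hv j
  have hprod : 0 ≤ ∏ j, R j := Finset.prod_nonneg fun j _ => hR0 j
  obtain ⟨h1, h2⟩ := mem_and_seqNorm_le (x := fun k => ∏ j, y j k)
    (E.toSubmodule.smul_mem ((∏ j, R j : ℝ) : ℂ) hsum) fun k => by
      have h3 : (∑ j, v j) k = ((∑ j, ‖w j k‖ ^ n : ℝ) : ℂ) := by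
        simp [v, Finset.sum_apply]
      rw [Pi.smul_apply, h3, norm_smul, Complex.norm_real, Complex.norm_real,
        Real.norm_of_nonneg hprod, Real.norm_of_nonneg (by positivity), norm_prod]
      calc ∏ j, ‖y j k‖ = (∏ j, R j) * ∏ j, ‖w j k‖ := by
            rw [← Finset.prod_mul_distrib]
            refine Finset.prod_congr rfl fun j _ => ?_
            rw [hw, mul_inv_cancel_left₀ (hz j)]
        _ ≤ _ := by
            gcongr
            exact prod_le_sum_pow hn fun j => norm_nonneg _
  refine ⟨h1, h2.trans ?_⟩
  rw [seqNorm_smul hsum, Complex.norm_real, Real.norm_of_nonneg hprod, mul_comm]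
  gcongr
  calc E.seqNorm (∑ j, v j) ≤ ∑ j, E.seqNorm (v j) := seqNorm_sum_le _ hv
    _ ≤ ∑ _j : Fin n, C ^ n := Finset.sum_le_sum fun j _ => hvn j
    _ = n * C ^ n := by simp

theorem holderTriple_of_inv_eq (hp : 1 ≤ p) (hpq : p < q) (hr : 1 / r = 1 / p - 1 / q) :
    r.HolderTriple q p where
  inv_add_inv_eq_inv := by rw [← one_div, ← one_div, ← one_div, hr]; ring
  left_pos := by linarith [one_le_of_inv_eq hp hpq hr]
  right_pos := by linarith

/-- Distribute `|x|^n` over the `n` factors: `|x|^n ∏ l_j = ∏ (l_j |x|)`, where each `l_j |x|` lies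
in `ℓ_p` by Hölder. -/
theorem LpEmbeds.ellN (hn : 1 ≤ n) (hp : 1 ≤ p) (hr1 : 1 ≤ r) (hpqr : r.HolderTriple q p)
    (h : E.LpEmbeds n p) : (E.ellNLp n r hr1).LpEmbeds n q := by
  obtain ⟨C, hC, hb⟩ := h
  have hq0 : 0 < q := hpqr.right_pos
  refine ⟨((n : ℝ) * C ^ n) ^ (1 / (n : ℝ)), by positivity, fun x hx => ?_⟩
  set S := (∑' k, ‖x k‖ ^ q) ^ (1 / q) with hS
  have hT0 : 0 ≤ ∑' k, ‖x k‖ ^ q := tsum_nonneg fun k => by positivity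
  have hS0 : 0 ≤ S := Real.rpow_nonneg hT0 _
  have hxS : ∀ k, ‖x k‖ ≤ S := fun k => by
    refine (Real.rpow_le_rpow_iff (norm_nonneg _) hS0 hq0).1 ?_
    rw [hS, ← Real.rpow_mul hT0, one_div_mul_cancel hq0.ne', Real.rpow_one]
    exact hx.le_tsum k fun _ _ => by positivity
  obtain ⟨hm, hle⟩ := ellN_mem_and_seqNorm_le (n := n) (G := ell r hr1) (E := E)
    (α := fun k => ((‖x k‖ ^ n : ℝ) : ℂ)) (B := n * C ^ n * S ^ n) (by positivity) fun l => by
      have hl : ∀ j, Summable fun k => ‖(l j).seq k‖ ^ r := fun j => (l j).2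
      have hnm : ∀ j k, ‖(l j).seq k * (‖x k‖ : ℂ)‖ = ‖(l j).seq k‖ * ‖x k‖ := fun j k => by
        simp
      have heq : (fun k => ((‖x k‖ ^ n : ℝ) : ℂ) * ∏ j, (l j).seq k) =
          fun k => ∏ j, ((l j).seq k * (‖x k‖ : ℂ)) := funext fun k => by
        rw [Finset.prod_mul_distrib]
        simp [mul_comm]
      have hsumm : ∀ j, Summable fun k => ‖(l j).seq k * (‖x k‖ : ℂ)‖ ^ p := fun j => by
        simp only [hnm]
        exact Real.summable_Lr_of_Lp_Lq_of_nonneg hpqr (fun k => norm_nonneg _)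
          (fun k => norm_nonneg _) (hl j) hx
      obtain ⟨h1, h2⟩ := hb.prod_mem_and_seqNorm_le hn hp
        (fun j k => (l j).seq k * (‖x k‖ : ℂ)) hsumm
      rw [heq]
      refine ⟨h1, h2.trans ?_⟩
      rw [mul_assoc ((n : ℝ) * C ^ n)]
      gcongr
      calc _ ≤ ∏ j, (‖l j‖ * S) := by
            refine Finset.prod_le_prod (fun j _ => Real.rpow_nonneg
              (tsum_nonneg fun k => by positivity) _) fun j _ => ?_
            simp only [hnm]
            exact Real.Lr_le_Lp_mul_Lq_tsum_of_nonneg hpqr (fun k => norm_nonneg _)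
              (fun k => norm_nonneg _) (hl j) hx
        _ = S ^ n * ∏ j, ‖l j‖ := by
            rw [Finset.prod_mul_distrib, mul_comm]
            simp
  refine ⟨⟨⟨S, by rintro _ ⟨k, rfl⟩; exact hxS k⟩, hm⟩, ?_⟩
  calc (E.ellNLp n r hr1).rootNorm n x ≤ (n * C ^ n * S ^ n) ^ (1 / (n : ℝ)) :=
        Real.rpow_le_rpow (seqNorm_nonneg _) hle (by positivity)
    _ = _ := by
        rw [Real.mul_rpow (by positivity) (by positivity), one_div,
          Real.pow_rpow_inv_natCast hS0 (by omega)]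

end Inclusion

/-! ### Summing operators -/

/-- Hölder for each functional separately; cutting `l` off after `m` terms does not increase its
norm. -/
theorem weakLpNorm_smul_le {X : Type*} [NormedAddCommGroup X] [NormedSpace ℂ X] {p q r : ℝ}
    (hpqr : r.HolderTriple q p) (hr : 1 ≤ r) {m : ℕ} (x : Fin m → X) (l : (ell r hr).Space) :
    weakLpNorm p (fun i => l.seq i • x i) ≤ ‖l‖ * weakLpNorm q x := by
  refine weakLpNorm_le fun φ hφ => ?_
  have h := Real.Lr_le_Lp_mul_Lq_tsum_of_nonneg hpqr (f := fun i : Fin m => ‖l.seq i‖)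
    (g := fun i => ‖φ (x i)‖) (fun k => norm_nonneg _) (fun k => norm_nonneg _)
    (Summable.of_finite) (Summable.of_finite)
  simp only [tsum_fintype] at h
  simp only [map_smul, norm_smul]
  refine h.trans (mul_le_mul ?_ (le_weakLpNorm hpqr.right_pos x φ hφ) (by positivity)
    (norm_nonneg _))
  change _ ≤ (∑' k, ‖l.seq k‖ ^ r) ^ (1 / r)
  have hl : Summable fun k => ‖l.seq k‖ ^ r := l.2
  have : 0 < r := hpqr.left_pos
  gcongr
  rw [Fin.sum_univ_eq_sum_range fun k => ‖l.seq k‖ ^ r]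
  exact hl.sum_le_tsum _ fun _ _ => by positivity

section Summing

variable {n : ℕ} {X : Fin n → Type*} [∀ j, NormedAddCommGroup (X j)] [∀ j, NormedSpace ℂ (X j)]
  {Y : Type*} [NormedAddCommGroup Y] [NormedSpace ℂ Y] {E : KotheSpace}
  {T : ContinuousMultilinearMap ℂ X Y}

theorem summingNorm_le {p C : ℝ} (hC : 0 < C) (h : E.SummingBound p T C) :
    E.summingNorm p T ≤ C :=
  csInf_le ⟨0, fun _ hx => hx.1.le⟩ ⟨hC, h⟩

/-- A comparison of the defining inequalities gives a comparison of the norms. -/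
theorem summingNorm_le_mul {F : KotheSpace} {p q c : ℝ} (hc : 0 < c)
    (h : ∀ C, 0 < C → E.SummingBound p T C → F.SummingBound q T (c * C))
    (hT : T ∈ E.summing X Y p) : F.summingNorm q T ≤ c * E.summingNorm p T := by
  rw [← div_le_iff₀' hc]
  -- Membership of `T` makes the set of constants nonempty.
  refine le_csInf hT fun C hC => ?_
  rw [div_le_iff₀' hc]
  exact summingNorm_le (mul_pos hc hC.1) (h C hC.1 hC.2)

/-- The estimate itself preserves the product `C * E.inclNorm n p`; the quotient of inclusion norms
only accounts for the normalization in `SummingBound`. -/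
theorem SummingBound.ellN {p q r C : ℝ} (hn : 1 ≤ n) (hp : 1 ≤ p) (hr1 : 1 ≤ r)
    (hpqr : r.HolderTriple q p) (hE : E.LpEmbeds n p) (hC : 0 < C) (h : E.SummingBound p T C) :
    (E.ellNLp n r hr1).SummingBound q T
      (E.inclNorm n p * ((E.ellNLp n r hr1).inclNorm n q)⁻¹ * C) := by
  intro m x
  have hc := (hE.ellN hn hp hr1 hpqr).one_le_inclNorm hn hpqr.right_pos
  have hc' : (E.ellNLp n r hr1).inclNorm n q ≠ 0 := by linarith
  have hcp := E.inclNorm_nonneg n p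
  have hw : 0 ≤ ∏ j, weakLpNorm q (x j) := Finset.prod_nonneg fun j _ => weakLpNorm_nonneg _ _
  rw [show E.inclNorm n p * ((E.ellNLp n r hr1).inclNorm n q)⁻¹ * C *
    (E.ellNLp n r hr1).inclNorm n q = C * E.inclNorm n p by field_simp]
  refine (ellN_mem_and_seqNorm_le (by positivity) fun l => ?_).2
  have hnorm : ∀ k, ‖extendZero (fun i => ‖T fun j => x j i‖) k * ∏ j, (l j).seq k‖ ≤
      ‖extendZero (fun i : Fin m => ‖T fun j => (l j).seq i • x j i‖) k‖ := fun k => by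
    rw [norm_mul, norm_extendZero fun _ => norm_nonneg _, norm_extendZero fun _ => norm_nonneg _]
    split_ifs with hk
    · rw [T.map_smul_univ (fun j => (l j).seq k) fun j => x j ⟨k, hk⟩, norm_smul, mul_comm]
    · simp
  obtain ⟨h1, h2⟩ := mem_and_seqNorm_le (E.extendZero_mem _) hnorm
  refine ⟨h1, h2.trans ((h m fun j i => (l j).seq i • x j i).trans ?_)⟩
  rw [mul_assoc (C * E.inclNorm n p), ← Finset.prod_mul_distrib]
  gcongr with j
  · exact fun j _ => weakLpNorm_nonneg _ _
  · rw [mul_comm]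
    exact weakLpNorm_smul_le hpqr hr1 (x j) (l j)

/-- Passage from `(ℓ_n(𝓛; ℓ₂, E), 2)`-summing to `(E, 1)`-summing for domains in which finite
sequences `x` split as `λ y` with `‖λ‖₂ ≤ 1` and `w₂(y) ≤ K w₁(x)`. -/
theorem SummingBound.of_ellN_two {C : ℝ} (hn : 1 ≤ n) {K : Fin n → ℝ}
    (hX : ∀ j (m : ℕ) (x : Fin m → X j), ∃ (l : Fin m → ℝ) (y : Fin m → X j),
      (∀ i, 0 ≤ l i) ∧ ∑ i, l i ^ 2 ≤ 1 ∧ (∀ i, x i = ((l i : ℝ) : ℂ) • y i) ∧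
        weakLpNorm 2 y ≤ K j * weakLpNorm 1 x)
    (hC : 0 < C) (h : (E.ellNLp n 2 one_le_two).SummingBound 2 T C) :
    E.SummingBound 1 T
      ((E.ellNLp n 2 one_le_two).inclNorm n 2 * (E.inclNorm n 1)⁻¹ * (∏ j, K j) * C) := by
  intro m x
  have hc' : E.inclNorm n 1 ≠ 0 := by linarith [(E.lpEmbeds_one hn).one_le_inclNorm hn one_pos]
  set c := (E.ellNLp n 2 one_le_two).inclNorm n 2
  have hc0 : 0 ≤ c := inclNorm_nonneg _ _ _
  choose l y hl0 hl hxy hw using fun j => hX j m (x j)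
  have hsq : ∀ j k, ‖extendZero (l j) k‖ ^ (2 : ℝ) =
      if h : k < m then l j ⟨k, h⟩ ^ 2 else 0 := fun j k => by
    rw [norm_extendZero (hl0 j)]
    split_ifs <;> simp
  let L : Fin n → (ell 2 one_le_two).Space := fun j =>
    ⟨extendZero (l j), (ell 2 one_le_two).extendZero_mem _⟩
  have hL : ∀ j, ‖L j‖ ≤ 1 := fun j => by
    change (∑' k, ‖extendZero (l j) k‖ ^ (2 : ℝ)) ^ (1 / 2 : ℝ) ≤ 1
    refine Real.rpow_le_one (tsum_nonneg fun k => by positivity) ?_ (by norm_num)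
    simp only [hsq]
    rw [tsum_eq_sum (s := Finset.range m) fun k hk => by
      simp only [Finset.mem_range] at hk; simp [hk]]
    rw [← Fin.sum_univ_eq_sum_range fun k => if h : k < m then l j ⟨k, h⟩ ^ 2 else 0]
    simpa using hl j
  -- Both sides agree: `T` pulls the scalars `l j` out of its arguments.
  have hnorm : ∀ k, ‖extendZero (fun i => ‖T fun j => x j i‖) k‖ ≤
      ‖extendZero (fun i => ‖T fun j => y j i‖) k * ∏ j, (L j).seq k‖ := fun k => by
    rw [norm_mul, norm_extendZero fun _ => norm_nonneg _, norm_extendZero fun _ => norm_nonneg _]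
    split_ifs with hk
    · have h1 : (fun j => x j ⟨k, hk⟩) = fun j => ((l j ⟨k, hk⟩ : ℝ) : ℂ) • y j ⟨k, hk⟩ :=
        funext fun j => hxy j _
      have h2 : ∀ j, (L j).seq k = ((l j ⟨k, hk⟩ : ℝ) : ℂ) := fun j => dif_pos hk
      rw [h1, T.map_smul_univ (fun j => ((l j ⟨k, hk⟩ : ℝ) : ℂ)), norm_smul, mul_comm]
      simp only [h2]
      exact le_rfl
    · simp
  have hmem := (E.ellNLp n 2 one_le_two).extendZero_mem fun i => ‖T fun j => y j i‖
  -- Membership has to be checked, since `seqNorm` is 0 outside `E`.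
  have hmemE : (fun k => extendZero (fun i => ‖T fun j => y j i‖) k * ∏ j, (L j).seq k) ∈
      E.toSubmodule := by
    have := (hmem.2.choose L).2
    convert this using 1
    exact funext fun k => (hmem.2.choose_spec L k).symm
  have hprod : ∏ j, ‖L j‖ ≤ 1 := Finset.prod_le_one (fun j _ => norm_nonneg _) fun j _ => hL j
  calc E.seqNorm (extendZero fun i => ‖T fun j => x j i‖)
      ≤ E.seqNorm (fun k => extendZero (fun i => ‖T fun j => y j i‖) k * ∏ j, (L j).seq k) :=
        (mem_and_seqNorm_le hmemE hnorm).2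
    _ ≤ (E.ellNLp n 2 one_le_two).seqNorm (extendZero fun i => ‖T fun j => y j i‖) *
          ∏ j, ‖L j‖ := seqNorm_mul_prod_le hmem L
    _ ≤ (E.ellNLp n 2 one_le_two).seqNorm (extendZero fun i => ‖T fun j => y j i‖) :=
        mul_le_of_le_one_right (seqNorm_nonneg _) hprod
    _ ≤ C * c * ∏ j, weakLpNorm 2 (y j) := h m y
    _ ≤ C * c * ∏ j, (K j * weakLpNorm 1 (x j)) := by
        gcongr with j
        · exact fun j _ => weakLpNorm_nonneg _ _
        · exact hw j
    _ = _ := by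
        rw [Finset.prod_mul_distrib]
        field_simp

end Summing

end KotheSpace

/-! ### The inclusion theorem -/

theorem theorem4p6 {n : ℕ} (hn : 1 ≤ n) (E : KotheSpace)
    (X : Fin n → Type*) [∀ j, NormedAddCommGroup (X j)] [∀ j, NormedSpace ℂ (X j)]
    [∀ j, CompleteSpace (X j)]
    (Y : Type*) [NormedAddCommGroup Y] [NormedSpace ℂ Y] [CompleteSpace Y] :
    (∀ (p q r : ℝ) (hp : 1 ≤ p) (hpq : p < q) (hr : 1 / r = 1 / p - 1 / q), E.LpEmbeds n p →
      (E.ellNLp n r (one_le_of_inv_eq hp hpq hr)).LpEmbeds n q ∧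
      E.summing X Y p ⊆ (E.ellNLp n r (one_le_of_inv_eq hp hpq hr)).summing X Y q ∧
      ∀ T ∈ E.summing X Y p,
        (E.ellNLp n r (one_le_of_inv_eq hp hpq hr)).summingNorm q T ≤
          E.inclNorm n p * ((E.ellNLp n r (one_le_of_inv_eq hp hpq hr)).inclNorm n q)⁻¹ *
            E.summingNorm p T) ∧
    ((∀ j, HasCotypeTwo (X j)) →
      (E.ellNLp n 2 one_le_two).summing X Y 2 = E.summing X Y 1 ∧
      ∃ C > 0, ∀ T ∈ E.summing X Y 1,
        E.summingNorm 1 T ≤ C * (E.ellNLp n 2 one_le_two).summingNorm 2 T ∧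
        (E.ellNLp n 2 one_le_two).summingNorm 2 T ≤ C * E.summingNorm 1 T) := by
  have inclusion : ∀ (p q r : ℝ) (hp : 1 ≤ p) (hpq : p < q) (hr : 1 / r = 1 / p - 1 / q),
      E.LpEmbeds n p →
      (E.ellNLp n r (one_le_of_inv_eq hp hpq hr)).LpEmbeds n q ∧
      E.summing X Y p ⊆ (E.ellNLp n r (one_le_of_inv_eq hp hpq hr)).summing X Y q ∧
      ∀ T ∈ E.summing X Y p,
        (E.ellNLp n r (one_le_of_inv_eq hp hpq hr)).summingNorm q T ≤
          E.inclNorm n p * ((E.ellNLp n r (one_le_of_inv_eq hp hpq hr)).inclNorm n q)⁻¹ *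
            E.summingNorm p T := by
    intro p q r hp hpq hr hE
    have hpqr := KotheSpace.holderTriple_of_inv_eq hp hpq hr
    have hr1 := one_le_of_inv_eq hp hpq hr
    have hF := hE.ellN hn hp hr1 hpqr
    have hc : 0 < E.inclNorm n p * ((E.ellNLp n r hr1).inclNorm n q)⁻¹ :=
      mul_pos (by linarith [hE.one_le_inclNorm hn (by linarith)])
        (inv_pos.2 (by linarith [hF.one_le_inclNorm hn (by linarith)]))
    refine ⟨hF, ?_, fun T hT =>
      KotheSpace.summingNorm_le_mul hc (fun C hC h => h.ellN hn hp hr1 hpqr hE hC) hT⟩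
    rintro T ⟨C, hC, h⟩
    exact ⟨_, mul_pos hc hC, h.ellN hn hp hr1 hpqr hE hC⟩
  refine ⟨inclusion, fun hX => ?_⟩
  choose K hK hfac using fun j => (hX j).exists_factorization
  have hE := E.lpEmbeds_one hn
  obtain ⟨hF, hsub, hle⟩ := inclusion 1 2 2 le_rfl one_lt_two (by norm_num) hE
  set F := E.ellNLp n 2 one_le_two
  have hcE : 0 < E.inclNorm n 1 := by linarith [hE.one_le_inclNorm hn one_pos]
  have hcF : 0 < F.inclNorm n 2 := by linarith [hF.one_le_inclNorm hn two_pos]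
  have hKp : 0 < ∏ j, K j := Finset.prod_pos fun j _ => hK j
  have hback : ∀ T : ContinuousMultilinearMap ℂ X Y, ∀ C, 0 < C → F.SummingBound 2 T C →
      E.SummingBound 1 T (F.inclNorm n 2 * (E.inclNorm n 1)⁻¹ * (∏ j, K j) * C) :=
    fun T C hC h => h.of_ellN_two hn hfac hC
  have hc1 : 0 < F.inclNorm n 2 * (E.inclNorm n 1)⁻¹ * ∏ j, K j := by positivity
  have hc2 : 0 < E.inclNorm n 1 * (F.inclNorm n 2)⁻¹ := by positivity
  -- The sum of the constants of the two comparisons dominates each of them.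
  refine ⟨Set.Subset.antisymm ?_ hsub, F.inclNorm n 2 * (E.inclNorm n 1)⁻¹ * (∏ j, K j) +
    E.inclNorm n 1 * (F.inclNorm n 2)⁻¹, by positivity, fun T hT => ⟨?_, ?_⟩⟩
  · rintro T ⟨C, hC, h⟩
    exact ⟨_, mul_pos hc1 hC, hback T C hC h⟩
  · refine (KotheSpace.summingNorm_le_mul hc1 (hback T) (hsub hT)).trans ?_
    have : 0 ≤ F.summingNorm 2 T := Real.sInf_nonneg fun _ h => h.1.le
    gcongr
    linarith
  · refine (hle T hT).trans ?_
    have : 0 ≤ E.summingNorm 1 T := Real.sInf_nonneg fun _ h => h.1.le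
    gcongr
    change E.inclNorm n 1 * (F.inclNorm n 2)⁻¹ ≤ _
    linarith
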